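/- Let $\mathbb K$ be a field and let $X$ be a normal variety over $\mathbb K$ (a normal integral separated scheme of finite type over $\mathbb K$) with a Bruhat decomposition: a finite decomposition $X=\coprod_{w\in I}X_w^\circ$ into locally closed irreducible strata such that each closure $X_w:=\overline{X_w^\circ}$ is a union of strata, there is a unique $0$-dimensional stratum, and each intersection $X_w\cap X_v$ is a union of strata. Put $|w|:=\dim X_w$. Let $\mathcal Y_1,\dots,\mathcal Y_r\subseteq X\times\mathbb A^1$ be closed subschemes, flat over $\mathbb A^1$, such that for every point $s\in\mathbb A^1$ every irreducible component of the fibre $Y_i(s)$ has codimension $1$, i.e. dimension $\dim X-1$. Suppose that each $\mathcal Y_i$ respects the Bruhat decomposition: for every $w\in I$ the support of the scheme-theoretic limit $\lim_{s\to0}(Y_i(s)\cap X_w)$ (the fibre over $0$ of the scheme-theoretic closure of the restriction to $\mathbb A^1\setminus\{0\}$ of the family $\mathcal Y_i\cap(X_w\times\mathbb A^1)$) is a union of Schubert varieties $X_v\subseteq X_w$ with $|v|=|w|-1$. Suppose also that $\bigcap_{s\in\mathbb A^1}Y_i(s)=\emptyset$ for each $i$, i.e. there is no point $x\in X$ with $\{x\}\times\mathbb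 A^1\subseteq\mathcal Y_i$. Then $\mathcal Y_1,\dots,\mathcal Y_r$ are in general position: for all $w\in I$ and $1\le k\le r$ there is a non-empty open subset $U$ of the scheme $\mathbb A^k$ such that for every point $(s_1,\dots,s_k)\in U$ the intersection $$Y_1(s_1)\cap\cdots\cap Y_k(s_k)\cap X_w$$ is either empty or of dimension $|w|-k$. -/

import Mathlib

open CategoryTheory AlgebraicGeometry

universe u

noncomputable section

namespace SchubertInduction

/-- A finite decomposition `X = ∐ X°_w` of (the underlying space of) a scheme, in the intended use
an integral separated scheme of finite type over a field, into locally closed irreducible strata. -/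
structure BruhatDecomposition (X : Scheme.{u}) (I : Type*) where
  /-- the strata `X°_w` -/
  cell : I → Set X
  finite : Finite I
  pairwise_disjoint : Pairwise fun v w => Disjoint (cell v) (cell w)
  iUnion_cell : ⋃ w, cell w = Set.univ
  isLocallyClosed_cell : ∀ w, IsLocallyClosed (cell w)
  isIrreducible_cell : ∀ w, IsIrreducible (cell w)
  /-- the closure of each stratum is a union of strata -/
  closure_cell : ∀ w, ∃ A : Set I, closure (cell w) = ⋃ v ∈ A, cell v
  /-- there is a unique 0-dimensional stratum -/
  existsUnique_dim_zero : ∃! w, topologicalKrullDim (cell w) = 0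
  /-- the intersection of two closures is a union of strata -/
  closure_inter_closure : ∀ w v, ∃ A : Set I,
    closure (cell w) ∩ closure (cell v) = ⋃ u ∈ A, cell u

namespace BruhatDecomposition

variable {X : Scheme.{u}} {I : Type*} (B : BruhatDecomposition X I)

/-- The Schubert variety `X_w`, the closure of `X°_w`, as a closed subset. -/
def schubert (w : I) : TopologicalSpace.Closeds X := .closure (B.cell w)

/-- `|w| = dim X_w`. -/
def dim (w : I) : WithBot ℕ∞ := topologicalKrullDim (B.schubert w)

/-- The ideal sheaf of `X_w` with its reduced structure. -/
def schubertIdeal (w : I) : X.IdealSheafData := Scheme.IdealSheafData.vanishingIdeal (B.schubert w)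

end BruhatDecomposition

/-- A scheme is normal if all its local rings are integrally closed domains
(for an integral scheme they are domains anyway). -/
def IsNormalScheme (X : Scheme.{u}) : Prop :=
  ∀ x : X, IsDomain (X.presheaf.stalk x) ∧ IsIntegrallyClosed (X.presheaf.stalk x)

/-- `X × 𝔸ᵏ`. When `X` is a scheme over `S`, this is the fibre product over `S` of `X` and `𝔸ᵏ_S`. -/
abbrev ProdAff (k : ℕ) (X : Scheme.{u}) : Scheme.{u} := 𝔸(ULift.{u} (Fin k); X)

/-- The projection `X × 𝔸ᵏ ⟶ X`. -/
abbrev toBase (k : ℕ) (X : Scheme.{u}) : ProdAff k X ⟶ X := 𝔸(ULift.{u} (Fin k); X) ↘ X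

/-- The projection `X × 𝔸ᵏ ⟶ 𝔸ᵏ` for `X` over the field `K`. -/
abbrev toAff (K : Type u) [Field K] (k : ℕ) (X : Scheme.{u}) [X.Over (Spec (.of K))] :
    ProdAff k X ⟶ ProdAff k (Spec (.of K)) :=
  AffineSpace.map (ULift.{u} (Fin k)) (X ↘ Spec (.of K))

/-- The morphism `X × 𝔸ᵏ ⟶ X × 𝔸¹`, `(x, s₁, …, s_k) ↦ (x, s_i)`. -/
abbrev toLine (k : ℕ) (i : Fin k) (X : Scheme.{u}) : ProdAff k X ⟶ ProdAff 1 X :=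
  AffineSpace.reindex (fun _ : ULift.{u} (Fin 1) => (ULift.up i : ULift.{u} (Fin k))) X

/-- The inclusion `X ⟶ X × 𝔸¹`, `x ↦ (x, 0)`, of the fibre over `0 ∈ 𝔸¹`. -/
def zeroSection (X : Scheme.{u}) : X ⟶ ProdAff 1 X :=
  AffineSpace.homOfVector (𝟙 X) (fun _ => 0)

/-- The open subscheme `X × (𝔸¹ ∖ {0})` of `X × 𝔸¹`. -/
def punctured (X : Scheme.{u}) : (ProdAff 1 X).Opens :=
  (ProdAff 1 X).basicOpen (AffineSpace.coord X (ULift.up 0))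

/-- The scheme-theoretic limit `lim_{s → 0} Z(s)` of the family over `𝔸¹` given by the closed
subscheme `Z` of `X × 𝔸¹` with ideal sheaf `J`: restrict `Z` to `𝔸¹ ∖ {0}`, take the
scheme-theoretic closure in `X × 𝔸¹`, and take the fibre of that over `0`. -/
def limitAtZero {X : Scheme.{u}} (J : (ProdAff 1 X).IdealSheafData) : X.IdealSheafData :=
  ((J.subschemeι ⁻¹ᵁ punctured X).ι ≫ J.subschemeι).ker.comap (zeroSection X)

/-- The closed subscheme `𝒴` of `X × 𝔸¹` with ideal sheaf `Y` is a flat family over `𝔸¹` of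
codimension-`c` subschemes of `X`: it is flat over `𝔸¹`, and every irreducible component of every
fibre `Y(s)`, a closed subscheme of `X ⊗ κ(s)`, has dimension `dim X - c`. -/
structure IsFamilyOfCodim (K : Type u) [Field K] {X : Scheme.{u}} [X.Over (Spec (.of K))]
    (Y : (ProdAff 1 X).IdealSheafData) (c : ℕ) : Prop where
  flat : Flat (Y.subschemeι ≫ toAff K 1 X)
  codim : ∀ s : ProdAff 1 (Spec (.of K)),
    ∀ Z ∈ irreducibleComponents ((Y.subschemeι ≫ toAff K 1 X).fiber s),
      topologicalKrullDim Z + c = topologicalKrullDim X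

/-- A codimension-`c` family respects the decomposition: for every `w`, the limit of `Y(s) ∩ X_w`
as `s → 0` is supported on a union of Schubert subvarieties of codimension `c` in `X_w`. -/
def Respects {X : Scheme.{u}} {I : Type*} (B : BruhatDecomposition X I)
    (Y : (ProdAff 1 X).IdealSheafData) (c : ℕ) : Prop :=
  ∀ w, ∃ A : Set I,
    (∀ v ∈ A, B.schubert v ≤ B.schubert w ∧ B.dim v + c = B.dim w) ∧
    ((limitAtZero (Y ⊔ (B.schubertIdeal w).comap (toBase 1 X))).support : Set X) =
      ⋃ v ∈ A, (B.schubert v : Set X)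

/-- The set `⋂_{s ∈ 𝔸¹} Y(s)` of the points `x` of `X` with `{x} × 𝔸¹ ⊆ 𝒴`. (For infinite `K`, it
is enough to test the points `(x, s)` with `s ∈ K`; in this form the set is the right one for
every field `K`, and never larger than the intersection over `s ∈ K`.) -/
def fibreIntersection {X : Scheme.{u}} (Y : (ProdAff 1 X).IdealSheafData) : Set X :=
  {x | ∀ z : ProdAff 1 X, toBase 1 X z = x → z ∈ Y.support}

/-- The family over `𝔸ᵏ` with fibre `Y₁(s₁) ∩ ⋯ ∩ Y_k(s_k) ∩ X_w` over `(s₁, …, s_k)`, as a closed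
subscheme of `X × 𝔸ᵏ` (the sum of ideals cuts out the scheme-theoretic intersection). -/
def intersectionFamily {X : Scheme.{u}} {I : Type*} (B : BruhatDecomposition X I) {k : ℕ}
    (Y : Fin k → (ProdAff 1 X).IdealSheafData) (w : I) : (ProdAff k X).IdealSheafData :=
  (⨆ i, (Y i).comap (toLine k i X)) ⊔ (B.schubertIdeal w).comap (toBase k X)

/-- The intersection `Y₁(s₁) ∩ ⋯ ∩ Y_k(s_k) ∩ X_w` for a point `s = (s₁, …, s_k)` of the scheme `𝔸ᵏ`;
it is a closed subscheme of `X ⊗ κ(s)`. -/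
def intersectionAt (K : Type u) [Field K] {X : Scheme.{u}} [X.Over (Spec (.of K))] {I : Type*}
    (B : BruhatDecomposition X I) {k : ℕ} (Y : Fin k → (ProdAff 1 X).IdealSheafData) (w : I)
    (s : ProdAff k (Spec (.of K))) : Scheme.{u} :=
  ((intersectionFamily B Y w).subschemeι ≫ toAff K k X).fiber s

/-- A collection of families of codimensions `c₁, …, c_r` is in general position: for `1 ≤ k ≤ r`
and all `w`, there is a non-empty open subset of `𝔸ᵏ` over which the intersection of
`Y₁(s₁), …, Y_k(s_k)` and `X_w` is empty or has dimension `|w| - (c₁ + ⋯ + c_k)`. -/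
def InGeneralPosition (K : Type u) [Field K] {X : Scheme.{u}} [X.Over (Spec (.of K))] {I : Type*}
    (B : BruhatDecomposition X I) {r : ℕ} (Y : Fin r → (ProdAff 1 X).IdealSheafData)
    (c : Fin r → ℕ) : Prop :=
  ∀ (k : ℕ) (_ : 1 ≤ k) (hk : k ≤ r) (w : I),
    ∃ U : (ProdAff k (Spec (.of K))).Opens, (U : Set (ProdAff k (Spec (.of K)))).Nonempty ∧
      ∀ s ∈ U,
        IsEmpty (intersectionAt K B (fun i => Y (Fin.castLE hk i)) w s) ∨
        topologicalKrullDim (intersectionAt K B (fun i => Y (Fin.castLE hk i)) w s)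
          + ((∑ i : Fin k, c (Fin.castLE hk i) : ℕ) : WithBot ℕ∞) = B.dim w

end SchubertInduction

end

/-! ### Dimension and integral extensions -/

namespace SchubertInduction

open PrimeSpectrum

section Order

variable {α β : Type*} [Preorder α] [Preorder β]

/-! The question is local on `X`. Let `A` be the ring of an affine chart, a normal domain of finite
type over `K`, let `p` be the prime of `X_w` in `A`, and let `I i` be the ideal in `A[X]` of the
support of the `i`-th family. Over `𝔸ᵏ` the intersection is the closed subset of `Spec (A/p)[X_1, …,
X_k]` cut out by all the `I i`, the `i`-th one written in the variable `X_i`. Its fibre dimension is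
constant over a non-empty open set (`exists_krullDim_fiber_eq`), so only the fibre over the generic
point of `𝔸ᵏ` has to be computed. There height and coheight add up to `|w|`
(`height_add_coheight_genericFiber`), and it suffices that every prime `Q` containing all the `I i`
has height at least `k`, and a minimal one height at most `k`.

Lower bound (`card_le_height_of_chartIdeal_le`): since no `{x} × 𝔸¹` lies in the family, `I i ⊈
q[X]` for every prime `q` of `A`. Start from the extension to the polynomial ring of the contraction
of `Q`, and force one variable after another to equal its class modulo `Q`. Each of the `k` steps
enlarges the prime strictly, and the last prime is `Q`.

Upper bound (`height_le_card_of_mem_minimalPrimes_chartIdeal`): flatness and the codimension of the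
fibres give the minimal primes of `I i` height at most one. By Kronecker's theorem on coefficients
of products, such a prime is principal locally on the normal scheme `X`
(`exists_eq_span_singleton_of_not_le_map_C`). So near `Q` each family is given by one equation,
which restricts to `X_w` whether or not `X_w` is normal, and Krull's height theorem applies.

Finitely many charts suffice, and all those meeting `X_w` see the same dimension `|w|`. -/

theorem krullDim_eq_of_strictMono_of_lifting {f : α → β} (hf : StrictMono f)
    (hsurj : Function.Surjective f) (hup : ∀ a b, f a < b → ∃ a', a < a' ∧ f a' = b) :
    Order.krullDim α = Order.krullDim β := by
  -- The dimension is the supremum of the coheights, and lifting of larger elements makes `f`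
  -- preserve coheights.
  rw [Order.krullDim_eq_iSup_coheight, Order.krullDim_eq_iSup_coheight]
  exact hsurj.iSup_congr _ fun a => by rw [Order.coheight_eq_of_strictMono f hf hup a]

end Order

section Integral

variable {R S B : Type*} [CommRing R] [CommRing S] [CommRing B] [Algebra R S] [Algebra R B]
  [Algebra S B] [IsScalarTower R S B]

/-- Incomparability, lying over and going up hold within a single fibre over `R`, because a prime of
`B` and its contraction to `S` lie over the same prime of `R`. -/
theorem krullDim_fiber_eq_of_isIntegral [Algebra.IsIntegral S B]
    (hinj : Function.Injective (algebraMap S B)) (p : PrimeSpectrum R) :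
    Order.krullDim (comap (algebraMap R B) ⁻¹' {p}) =
      Order.krullDim (comap (algebraMap R S) ⁻¹' {p}) := by
  have hcomp (Q : PrimeSpectrum B) :
      comap (algebraMap R S) (comap (algebraMap S B) Q) = comap (algebraMap R B) Q := by
    rw [IsScalarTower.algebraMap_eq R S B, comap_comp_apply]
  refine krullDim_eq_of_strictMono_of_lifting
    (f := fun Q => ⟨comap (algebraMap S B) Q.1, by
      rw [Set.mem_preimage, hcomp]; exact Q.2⟩) ?_ ?_ ?_
  · intro Q Q' h
    exact Ideal.IsIntegral.comap_lt_comap (R := S) (A := B) (I := Q.1.asIdeal)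
      (J := Q'.1.asIdeal) h
  · rintro ⟨q, hq⟩
    obtain ⟨Q, -, hQ, e⟩ := Ideal.exists_ideal_over_prime_of_isIntegral q.asIdeal (⊥ : Ideal B)
      (by rw [← RingHom.ker_eq_comap_bot, (RingHom.injective_iff_ker_eq_bot _).mp hinj]
          exact bot_le)
    have e' : comap (algebraMap S B) ⟨Q, hQ⟩ = q := PrimeSpectrum.ext e
    exact ⟨⟨⟨Q, hQ⟩, by rw [Set.mem_preimage, ← hcomp, e']; exact hq⟩, Subtype.ext e'⟩
  · rintro ⟨Q, hQ⟩ ⟨q, hq⟩ hlt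
    obtain ⟨Q', hle, hQ', e⟩ := Ideal.exists_ideal_over_prime_of_isIntegral_of_isPrime q.asIdeal
      Q.asIdeal (show comap (algebraMap S B) Q ≤ q from hlt.le)
    have e' : comap (algebraMap S B) ⟨Q', hQ'⟩ = q := PrimeSpectrum.ext e
    refine ⟨⟨⟨Q', hQ'⟩, by rw [Set.mem_preimage, ← hcomp, e']; exact hq⟩, ?_, Subtype.ext e'⟩
    refine lt_of_le_of_ne hle fun h => hlt.ne (Subtype.ext ?_)
    have : Q = ⟨Q', hQ'⟩ := congrArg Subtype.val h
    subst this
    exact e'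

theorem ringKrullDim_eq_of_isIntegral [Algebra.IsIntegral S B]
    (hinj : Function.Injective (algebraMap S B)) : ringKrullDim B = ringKrullDim S := by
  refine krullDim_eq_of_strictMono_of_lifting (f := comap (algebraMap S B)) ?_ ?_ ?_
  · intro Q Q' h
    exact Ideal.IsIntegral.comap_lt_comap (R := S) (A := B) (I := Q.asIdeal) (J := Q'.asIdeal) h
  · intro q
    obtain ⟨Q, -, hQ, e⟩ := Ideal.exists_ideal_over_prime_of_isIntegral q.asIdeal (⊥ : Ideal B)
      (by rw [← RingHom.ker_eq_comap_bot, (RingHom.injective_iff_ker_eq_bot _).mp hinj]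
          exact bot_le)
    exact ⟨⟨Q, hQ⟩, PrimeSpectrum.ext e⟩
  · intro Q q hlt
    obtain ⟨Q', hle, hQ', e⟩ := Ideal.exists_ideal_over_prime_of_isIntegral_of_isPrime q.asIdeal
      Q.asIdeal (show comap (algebraMap S B) Q ≤ q from hlt.le)
    have e' : comap (algebraMap S B) ⟨Q', hQ'⟩ = q := PrimeSpectrum.ext e
    refine ⟨⟨Q', hQ'⟩, lt_of_le_of_ne hle ?_, e'⟩
    rintro rfl
    exact hlt.ne e'

end Integral

theorem krullDim_fiber_mvPolynomial (R : Type*) [CommRing R] (n : ℕ) (p : PrimeSpectrum R) :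
    Order.krullDim (comap (algebraMap R (MvPolynomial (Fin n) R)) ⁻¹' {p}) = n := by
  rw [Order.krullDim_eq_of_orderIso
      (PrimeSpectrum.preimageOrderIsoFiber R (MvPolynomial (Fin n) R) p), ← ringKrullDim,
    ringKrullDim_eq_of_ringEquiv
      (MvPolynomial.algebraTensorAlgEquiv R p.asIdeal.ResidueField).toRingEquiv]
  simp [MvPolynomial.ringKrullDim_of_isNoetherianRing]

/-- If `B₀ → B` becomes an isomorphism after inverting `g`, then the primes of `B₀` and `B` not
containing `g` correspond. -/
theorem exists_comap_eq_of_away {B₀ B : Type*} [CommRing B₀] [CommRing B] {f : B₀ →+* B}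
    (hf : Function.Injective f) {g : B₀} (hg : ∀ b, ∃ n : ℕ, ∃ a, f a = f g ^ n * b)
    (q : PrimeSpectrum B₀) (hq : g ∉ q.asIdeal) :
    ∃ Q : PrimeSpectrum B, comap f Q = q := by
  -- The only candidate: the elements that a power of `g` moves into `q`.
  let J : Ideal B :=
    { carrier := {b | ∃ n : ℕ, ∃ a ∈ q.asIdeal, f a = f g ^ n * b}
      add_mem' := by
        rintro b b' ⟨n, a, ha, e⟩ ⟨n', a', ha', e'⟩
        refine ⟨n + n', g ^ n' * a + g ^ n * a', add_mem (Ideal.mul_mem_left _ _ ha)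
          (Ideal.mul_mem_left _ _ ha'), ?_⟩
        simp only [map_add, map_mul, map_pow, e, e']
        ring
      zero_mem' := ⟨0, 0, zero_mem _, by simp⟩
      smul_mem' := by
        rintro c b ⟨n, a, ha, e⟩
        obtain ⟨m, d, e'⟩ := hg c
        refine ⟨m + n, d * a, Ideal.mul_mem_left _ _ ha, ?_⟩
        simp only [map_mul, e, e', smul_eq_mul]
        ring }
  have hJ {a : B₀} : f a ∈ J ↔ a ∈ q.asIdeal := by
    constructor
    · rintro ⟨n, a', ha', e⟩
      have : a' = g ^ n * a := hf (by simp [e])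
      rw [this] at ha'
      exact (q.2.mem_or_mem ha').resolve_left fun h => hq (q.2.mem_of_pow_mem _ h)
    · exact fun h => ⟨0, a, h, by simp⟩
  refine ⟨⟨J, ⟨?_, ?_⟩⟩, PrimeSpectrum.ext (Ideal.ext fun a => hJ)⟩
  · rw [Ne, Ideal.eq_top_iff_one, ← map_one f, hJ]
    exact (Ideal.ne_top_iff_one _).mp q.2.ne_top
  · rintro b c ⟨n, a, ha, e⟩
    obtain ⟨m, b', eb⟩ := hg b
    obtain ⟨l, c', ec⟩ := hg c
    have : g ^ n * (b' * c') = g ^ (m + l) * a :=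
      hf (by simp only [map_mul, map_pow, e, eb, ec]; ring)
    have h2 : g ^ n * (b' * c') ∈ q.asIdeal := this ▸ Ideal.mul_mem_left _ _ ha
    have h3 := (q.2.mem_or_mem h2).resolve_left fun h => hq (q.2.mem_of_pow_mem _ h)
    rcases q.2.mem_or_mem h3 with h | h
    · exact .inl ⟨m, b', h, eb⟩
    · exact .inr ⟨l, c', h, ec⟩

theorem comap_le_comap_of_away {B₀ B : Type*} [CommRing B₀] [CommRing B] {f : B₀ →+* B}
    {g : B₀} (hg : ∀ b, ∃ n : ℕ, ∃ a, f a = f g ^ n * b) {Q Q' : PrimeSpectrum B}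
    (hQ : f g ∉ Q'.asIdeal) (h : comap f Q ≤ comap f Q') : Q ≤ Q' := by
  intro b hb
  obtain ⟨n, a, e⟩ := hg b
  have h1 : a ∈ (comap f Q').asIdeal := h (show f a ∈ Q.asIdeal from e ▸ Ideal.mul_mem_left _ _ hb)
  have h2 : f a ∈ Q'.asIdeal := h1
  rw [e] at h2
  exact (Q'.2.mem_or_mem h2).resolve_left fun h => hQ (Q'.2.mem_of_pow_mem _ h)

end SchubertInduction

/-! ### Generic constancy of the fibre dimension -/

namespace SchubertInduction

open PrimeSpectrum nonZeroDivisors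

attribute [local instance] MvPolynomial.algebraMvPolynomial

section Generic

variable (R B : Type u) [CommRing R] [IsDomain R] [CommRing B] [Algebra R B]

/-- The localization of `B` at the nonzero elements of `R`. -/
abbrev GenericFiber : Type _ := Localization (Algebra.algebraMapSubmonoid B R⁰)

instance finiteType_genericFiber [Algebra.FiniteType R B] :
    Algebra.FiniteType (FractionRing R) (GenericFiber R B) := by
  have : IsLocalization (R⁰.map (algebraMap R B)) (GenericFiber R B) :=
    inferInstanceAs (IsLocalization (Algebra.algebraMapSubmonoid B R⁰) _)
  have h := RingHom.finiteType_localizationPreserves (algebraMap R B) R⁰ (FractionRing R)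
    (GenericFiber R B) (RingHom.finiteType_algebraMap.mpr inferInstance)
  exact RingHom.finiteType_algebraMap.mp h

/-- Noether normalization of the generic fibre, with variables coming from `B`. -/
theorem exists_aeval_genericFiber_injective_isIntegral [Algebra.FiniteType R B]
    [Nontrivial (GenericFiber R B)] : ∃ (n : ℕ) (b : Fin n → B),
      Function.Injective (MvPolynomial.aeval (R := FractionRing R)
        fun i => algebraMap B (GenericFiber R B) (b i)) ∧
      (MvPolynomial.aeval (R := FractionRing R)
        fun i => algebraMap B (GenericFiber R B) (b i)).toRingHom.IsIntegral := by
  obtain ⟨n, φ, hinj, hint⟩ :=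
    exists_integral_inj_algHom_of_fg (FractionRing R) (GenericFiber R B)
  have h (i : Fin n) : ∃ (m : R⁰) (b : B), algebraMap R (GenericFiber R B) m * φ (.X i) =
      algebraMap B (GenericFiber R B) b := by
    obtain ⟨⟨b, ⟨_, m, hm, rfl⟩⟩, e⟩ :=
      IsLocalization.surj (Algebra.algebraMapSubmonoid B R⁰) (φ (.X i))
    refine ⟨⟨m, hm⟩, b, ?_⟩
    rw [← e, mul_comm, IsScalarTower.algebraMap_apply R B (GenericFiber R B)]
  choose m b hb using h
  have hm (i : Fin n) : algebraMap R (FractionRing R) (m i) ≠ 0 :=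
    IsFractionRing.to_map_ne_zero_of_mem_nonZeroDivisors (m i).2
  -- Multiplying the variables by the denominators `m i`, which are units of the fraction field, is
  -- an automorphism with inverse `t`; it turns the normalization `φ` into one with variables from
  -- `B`.
  let s : MvPolynomial (Fin n) (FractionRing R) →ₐ[FractionRing R]
      MvPolynomial (Fin n) (FractionRing R) :=
    MvPolynomial.aeval fun i => .C (algebraMap R (FractionRing R) (m i)) * .X i
  let t : MvPolynomial (Fin n) (FractionRing R) →ₐ[FractionRing R]
      MvPolynomial (Fin n) (FractionRing R) :=
    MvPolynomial.aeval fun i => .C (algebraMap R (FractionRing R) (m i))⁻¹ * .X i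
  have hst : s.comp t = AlgHom.id _ _ := by
    apply MvPolynomial.algHom_ext
    intro i
    simp only [AlgHom.comp_apply, t, s, MvPolynomial.aeval_X, map_mul, MvPolynomial.algHom_C,
      AlgHom.id_apply, MvPolynomial.algebraMap_eq]
    rw [← mul_assoc, ← map_mul, inv_mul_cancel₀ (hm i), map_one, one_mul]
  have hts : t.comp s = AlgHom.id _ _ := by
    apply MvPolynomial.algHom_ext
    intro i
    simp only [AlgHom.comp_apply, t, s, MvPolynomial.aeval_X, map_mul, MvPolynomial.algHom_C,
      AlgHom.id_apply, MvPolynomial.algebraMap_eq]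
    rw [← mul_assoc, ← map_mul, mul_inv_cancel₀ (hm i), map_one, one_mul]
  have hφs : MvPolynomial.aeval (R := FractionRing R)
      (fun i => algebraMap B (GenericFiber R B) (b i)) = φ.comp s := by
    apply MvPolynomial.algHom_ext
    intro i
    simp only [AlgHom.comp_apply, s, MvPolynomial.aeval_X, map_mul, MvPolynomial.algHom_C, ← hb,
      ← IsScalarTower.algebraMap_apply]
  refine ⟨n, b, ?_, ?_⟩
  · rw [hφs]
    exact hinj.comp (Function.LeftInverse.injective (g := t) fun x => DFunLike.congr_fun hts x)
  · rw [hφs]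
    have hs : s.toRingHom.IsIntegral := RingHom.isIntegral_of_surjective _
      (Function.RightInverse.surjective (g := t) fun x => DFunLike.congr_fun hst x)
    exact hs.trans _ _ hint

/-- Over a domain, the fibre dimension of a finite type algebra is generically constant. -/
theorem exists_krullDim_fiber_eq [Algebra.FiniteType R B] :
    ∃ g : R, g ≠ 0 ∧ ∀ p : PrimeSpectrum R, g ∉ p.asIdeal →
      Order.krullDim (comap (algebraMap R B) ⁻¹' {p}) =
        Order.krullDim (comap (algebraMap R B) ⁻¹' {⟨⊥, Ideal.isPrime_bot⟩}) := by
  -- The zero prime does not contain `g`, so a value that is constant where `g` does not vanish is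
  -- the generic one.
  suffices h : ∃ (D : WithBot ℕ∞) (g : R), g ≠ 0 ∧ ∀ p : PrimeSpectrum R, g ∉ p.asIdeal →
      Order.krullDim (comap (algebraMap R B) ⁻¹' {p}) = D by
    obtain ⟨D, g, hg, h⟩ := h
    exact ⟨g, hg, fun p hp => (h p hp).trans (h _ (by simpa using hg)).symm⟩
  cases subsingleton_or_nontrivial (GenericFiber R B) with
  | inl hs =>
    obtain ⟨⟨_, g, hg, rfl⟩, e⟩ := (IsLocalization.eq_iff_exists
      (Algebra.algebraMapSubmonoid B R⁰) (GenericFiber R B)).mp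
        (Subsingleton.elim (algebraMap B (GenericFiber R B) 1) (algebraMap B (GenericFiber R B) 0))
    simp only [mul_one, mul_zero] at e
    refine ⟨⊥, g, nonZeroDivisors.ne_zero hg, fun p hp => ?_⟩
    have : IsEmpty (comap (algebraMap R B) ⁻¹' {p}) := by
      refine ⟨fun Q => hp ?_⟩
      have h1 : p = comap (algebraMap R B) Q.1 := Q.2.symm
      rw [h1]
      change algebraMap R B g ∈ Q.1.asIdeal
      rw [e]
      exact zero_mem _
    exact Order.krullDim_eq_bot
  | inr hn =>
    obtain ⟨n, b, hinj, hint⟩ := exists_aeval_genericFiber_injective_isIntegral R B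
    classical
    set ψF := MvPolynomial.aeval (R := FractionRing R)
        fun i => algebraMap B (GenericFiber R B) (b i) with hψF
    let ψ : (MvPolynomial (Fin n) R) →ₐ[R] B := MvPolynomial.aeval b
    algebraize [ψ.toRingHom, ψF.toRingHom]
    have : IsScalarTower R (MvPolynomial (Fin n) R) B := .of_algebraMap_eq' ψ.comp_algebraMap.symm
    have hsq : (algebraMap B (GenericFiber R B)).comp ψ.toRingHom =
        ψF.toRingHom.comp (MvPolynomial.map (algebraMap R (FractionRing R))) := by
      apply MvPolynomial.ringHom_ext
      · intro r
        simp [ψ, hψF, ← IsScalarTower.algebraMap_apply, MvPolynomial.aeval_C,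
          -MvPolynomial.algHom_C]
      · intro i
        simp [ψ, hψF]
    have : IsScalarTower (MvPolynomial (Fin n) R) (MvPolynomial (Fin n) (FractionRing R))
        (GenericFiber R B) := .of_algebraMap_eq' hsq
    have hψinj : Function.Injective ψ := by
      have h1 : Function.Injective ((algebraMap B (GenericFiber R B)).comp ψ.toRingHom) := by
        rw [hsq]
        exact hinj.comp (MvPolynomial.map_injective _ (IsFractionRing.injective R _))
      exact Function.Injective.of_comp (f := algebraMap B (GenericFiber R B)) h1
    have hlocB : IsLocalization (Algebra.algebraMapSubmonoid B
        (R⁰.map (MvPolynomial.C (σ := Fin n) (R := R)))) (GenericFiber R B) := by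
      have : Algebra.algebraMapSubmonoid B (R⁰.map (MvPolynomial.C (σ := Fin n) (R := R))) =
          Algebra.algebraMapSubmonoid B R⁰ := by
        ext x
        simp only [Algebra.algebraMapSubmonoid, Submonoid.mem_map, exists_exists_and_eq_and]
        simp only [IsScalarTower.algebraMap_apply R (MvPolynomial (Fin n) R) B,
          MvPolynomial.algebraMap_eq]
      rw [this]
      infer_instance
    -- Denominators are cleared twice: `m` makes the image of `x` in the generic fibre integral over
    -- `R[X_1, …, X_n]`, and `m'` carries the integral equation back to `B`.
    have key (x : B) : ∃ g : R, g ≠ 0 ∧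
        IsIntegral (MvPolynomial (Fin n) R) (algebraMap R B g * x) := by
      have hx : IsIntegral (MvPolynomial (Fin n) (FractionRing R))
          (algebraMap B (GenericFiber R B) x) := hint _
      obtain ⟨⟨_, m, hm, rfl⟩, hmx⟩ := hx.exists_multiple_integral_of_isLocalization
        (R⁰.map (MvPolynomial.C (σ := Fin n) (R := R))) _
      have hmx' : IsIntegral (MvPolynomial (Fin n) R)
          (algebraMap B (GenericFiber R B) (algebraMap R B m * x)) := by
        convert! hmx using 1
        rw [Submonoid.smul_def, Algebra.smul_def, map_mul,
          IsScalarTower.algebraMap_apply R (MvPolynomial (Fin n) R) B,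
          ← IsScalarTower.algebraMap_apply (MvPolynomial (Fin n) R) B]
        rfl
      obtain ⟨_, ⟨m', hm', rfl⟩, h⟩ := IsLocalization.exists_isIntegral_smul_of_isIntegral_map
        (R⁰.map (MvPolynomial.C (σ := Fin n) (R := R))) hmx'
      refine ⟨m' * m, mul_ne_zero (nonZeroDivisors.ne_zero hm') (nonZeroDivisors.ne_zero hm), ?_⟩
      convert! h using 1
      rw [Algebra.smul_def, map_mul, mul_assoc,
        IsScalarTower.algebraMap_apply R (MvPolynomial (Fin n) R) B m']
      rfl
    obtain ⟨t, ht⟩ := (inferInstance : Algebra.FiniteType R B).out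
    choose c hc hcint using key
    let g : R := ∏ x ∈ t, c x
    have hg0 : g ≠ 0 := Finset.prod_ne_zero_iff.mpr fun x _ => hc x
    -- `B₀` becomes equal to `B` once `g` is inverted and is integral over `R[X_1, …, X_n]`. Hence,
    -- where `g` does not vanish, the fibres of `B`, of `B₀` and of affine `n`-space have the same
    -- dimension.
    let B₀ := integralClosure (MvPolynomial (Fin n) R) B
    have hRmem (r : R) : algebraMap R B r ∈ B₀ := by
      rw [IsScalarTower.algebraMap_apply R (MvPolynomial (Fin n) R) B]
      exact B₀.algebraMap_mem _
    have hgt (x : B) (hx : x ∈ t) : algebraMap R B g * x ∈ B₀ := by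
      have : g = (∏ y ∈ t.erase x, c y) * c x := (Finset.prod_erase_mul t c hx).symm
      rw [this, map_mul, mul_assoc]
      exact mul_mem (hRmem _) (hcint x)
    have hpow (x : B) : ∃ k : ℕ, algebraMap R B g ^ k * x ∈ B₀ := by
      have hx : x ∈ Algebra.adjoin R (t : Set B) := ht ▸ Algebra.mem_top
      induction hx using Algebra.adjoin_induction with
      | mem x hx => exact ⟨1, by simpa using hgt x hx⟩
      | algebraMap r => exact ⟨0, by simpa using hRmem r⟩
      | add x y _ _ hx hy =>
        obtain ⟨k, hk⟩ := hx
        obtain ⟨l, hl⟩ := hy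
        refine ⟨k + l, ?_⟩
        have : algebraMap R B g ^ (k + l) * (x + y) =
            algebraMap R B g ^ l * (algebraMap R B g ^ k * x) +
              algebraMap R B g ^ k * (algebraMap R B g ^ l * y) := by ring
        rw [this]
        exact add_mem (mul_mem (pow_mem (hRmem g) _) hk) (mul_mem (pow_mem (hRmem g) _) hl)
      | mul x y _ _ hx hy =>
        obtain ⟨k, hk⟩ := hx
        obtain ⟨l, hl⟩ := hy
        refine ⟨k + l, ?_⟩
        have : algebraMap R B g ^ (k + l) * (x * y) =
            (algebraMap R B g ^ k * x) * (algebraMap R B g ^ l * y) := by ring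
        rw [this]
        exact mul_mem hk hl
    refine ⟨n, g, hg0, fun p hp => ?_⟩
    have hB₀inj : Function.Injective (algebraMap (MvPolynomial (Fin n) R) B₀) :=
      fun x y h => hψinj (congrArg Subtype.val h)
    rw [← krullDim_fiber_mvPolynomial R n p, ← krullDim_fiber_eq_of_isIntegral hB₀inj p]
    have hgg (x : B) : ∃ k : ℕ, ∃ a : B₀, algebraMap B₀ B a =
        algebraMap B₀ B (algebraMap R B₀ g) ^ k * x := by
      obtain ⟨k, hk⟩ := hpow x
      exact ⟨k, ⟨_, hk⟩, by rw [← IsScalarTower.algebraMap_apply R B₀ B]; rfl⟩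
    have hcomp (Q : PrimeSpectrum B) :
        comap (algebraMap R B₀) (comap (algebraMap B₀ B) Q) = comap (algebraMap R B) Q := by
      rw [IsScalarTower.algebraMap_eq R B₀ B, comap_comp_apply]
    have hle (Q Q' : PrimeSpectrum B) (hQ' : comap (algebraMap R B) Q' = p)
        (h : comap (algebraMap B₀ B) Q ≤ comap (algebraMap B₀ B) Q') : Q ≤ Q' := by
      refine comap_le_comap_of_away hgg ?_ h
      rw [← IsScalarTower.algebraMap_apply R B₀ B]
      rw [← hQ'] at hp
      exact hp
    have hfib (Q : comap (algebraMap R B) ⁻¹' {p}) :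
        comap (algebraMap B₀ B) Q.1 ∈ comap (algebraMap R B₀) ⁻¹' {p} := by
      rw [Set.mem_preimage, hcomp]
      exact Q.2
    refine krullDim_eq_of_strictMono_of_lifting (f := fun Q => ⟨_, hfib Q⟩) ?_ ?_ ?_
    · intro Q Q' h
      refine lt_of_le_not_ge (Ideal.comap_mono h.le) fun h' => h.not_ge (hle _ _ Q.2 h')
    · rintro ⟨q, hq⟩
      have hgq : algebraMap R B₀ g ∉ q.asIdeal := by
        rw [← show comap (algebraMap R B₀) q = p from hq] at hp
        exact hp
      obtain ⟨Q, hQ⟩ := exists_comap_eq_of_away (f := algebraMap B₀ B) Subtype.val_injective hgg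
        q hgq
      exact ⟨⟨Q, by rw [Set.mem_preimage, ← hcomp, hQ]; exact hq⟩, Subtype.ext hQ⟩
    · rintro Q ⟨q, hq⟩ hlt
      have hgq : algebraMap R B₀ g ∉ q.asIdeal := by
        rw [← show comap (algebraMap R B₀) q = p from hq] at hp
        exact hp
      obtain ⟨Q', hQ'⟩ := exists_comap_eq_of_away (f := algebraMap B₀ B) Subtype.val_injective hgg
        q hgq
      have hQ'p : comap (algebraMap R B) Q' = p := by rw [← hcomp, hQ']; exact hq
      refine ⟨⟨Q', hQ'p⟩, ?_, Subtype.ext hQ'⟩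
      refine lt_of_le_not_ge (hle _ _ hQ'p (hQ'.symm ▸ hlt.le)) fun h' => hlt.not_ge ?_
      change q ≤ comap (algebraMap B₀ B) Q.1
      rw [← hQ']
      exact Ideal.comap_mono h'

end Generic
end SchubertInduction

/-! ### The dimension formula for finitely generated domains -/

namespace SchubertInduction

open PrimeSpectrum

/-- Induction on `n`: as `F[X_1, …, X_n]` is Jacobson, a maximal ideal of the polynomial ring in one
more variable contracts to a maximal ideal, and the height grows by one. -/
theorem height_eq_of_isMaximal_mvPolynomial (F : Type*) [Field F] (n : ℕ)
    (m : Ideal (MvPolynomial (Fin n) F)) [hm : m.IsMaximal] : m.height = n := by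
  induction n with
  | zero =>
    have h := Ideal.height_le_ringKrullDim_of_ne_top hm.ne_top
    rw [MvPolynomial.ringKrullDim_of_isNoetherianRing] at h
    simp at h
    simpa using h
  | succ n ih =>
    let e := (MvPolynomial.finSuccEquiv F n).toRingEquiv
    rw [← RingEquiv.height_comap e.symm]
    set P := m.comap e.symm
    have hP : P.IsMaximal := Ideal.comap_isMaximal_of_equiv e.symm
    have : (P.under (MvPolynomial (Fin n) F)).IsMaximal :=
      Polynomial.isMaximal_comap_C_of_isJacobsonRing P
    have : P.LiesOver (P.under (MvPolynomial (Fin n) F)) := ⟨rfl⟩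
    rw [Polynomial.height_eq_height_add_one (P.under (MvPolynomial (Fin n) F)) P, ih]
    push_cast
    rfl

/-- The bound by the dimension is general. Conversely, let `Q` be minimal over an ideal `J` with `ht
Q` generators, and choose a maximal ideal `m ⊇ Q` that contains no other minimal prime of `J`. A
longest chain below `m` modulo `J` must lie above `Q`, and its length is at least `ht m - ht Q`. -/
theorem height_add_coheight_eq_of_forall_isMaximal {A : Type*} [CommRing A] [IsNoetherianRing A]
    [IsJacobsonRing A] {d : ℕ} (hd : ∀ m : Ideal A, m.IsMaximal → m.height = d)
    (hdim : ringKrullDim A = d) (Q : PrimeSpectrum A) :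
    Order.height Q + Order.coheight Q = d := by
  refine le_antisymm ?_ ?_
  · have : Nonempty (PrimeSpectrum A) := ⟨Q⟩
    have h := Order.krullDim_eq_iSup_height_add_coheight_of_nonempty (α := PrimeSpectrum A)
    rw [← ringKrullDim, hdim] at h
    have h2 : (d : ℕ∞) = ⨆ a : PrimeSpectrum A, Order.height a + Order.coheight a := by
      exact_mod_cast h
    rw [h2]
    exact le_iSup (fun a : PrimeSpectrum A => Order.height a + Order.coheight a) Q
  · obtain ⟨s, hs, hcard⟩ := Q.asIdeal.exists_finset_card_eq_height_of_isNoetherianRing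
    set J := Ideal.span (s : Set A)
    have hfin : J.minimalPrimes.Finite := J.finite_minimalPrimes_of_isNoetherianRing
    have hex : ∀ P ∈ J.minimalPrimes, P ≠ Q.asIdeal → ∃ g ∈ P, g ∉ Q.asIdeal := by
      intro P hP hne
      by_contra! h
      exact hne (le_antisymm h (hs.2 hP.1 h))
    classical
    choose! c hc hc' using hex
    let g := ∏ P ∈ hfin.toFinset.erase Q.asIdeal, c P
    have hg : g ∉ Q.asIdeal := by
      rw [Ideal.IsPrime.prod_mem_iff]
      push Not
      intro P hP
      simp only [Finset.mem_erase, Set.Finite.mem_toFinset] at hP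
      exact hc' P hP.2 hP.1
    have hgP (P) (hP : P ∈ J.minimalPrimes) (hne : P ≠ Q.asIdeal) : g ∈ P :=
      Ideal.mem_of_dvd _ (Finset.dvd_prod_of_mem _ (by simp [hP, hne])) (hc P hP hne)
    -- In a Jacobson ring `Q` is the intersection of the maximal ideals above it, so one of them
    -- avoids `g`.
    obtain ⟨m, hm, hQm, hgm⟩ : ∃ m : Ideal A, m.IsMaximal ∧ Q.asIdeal ≤ m ∧ g ∉ m := by
      have h1 := (isJacobsonRing_iff_prime_eq.mp ‹_›) Q.asIdeal Q.2
      by_contra! h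
      apply hg
      rw [← h1, Ideal.jacobson, Ideal.mem_sInf]
      exact fun {I} hI => h I hI.2 hI.1
    have hJm : J ≤ m := hs.1.2.trans hQm
    have h1 := Ideal.height_le_height_add_encard_of_subset (s : Set A) (p := m)
      (Ideal.span_le.mp hJm)
    rw [hd m hm, Set.encard_coe_eq_coe_finsetCard, hcard, add_comm] at h1
    rw [PrimeSpectrum.height_eq_orderHeight] at h1
    refine h1.trans (add_le_add_right ?_ _)
    have hp : (m.map (Ideal.Quotient.mk J)).IsPrime :=
      Ideal.map_isPrime_of_surjective Ideal.Quotient.mk_surjective (by simpa using hJm)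
    obtain ⟨l, hl, hlen⟩ := (m.map (Ideal.Quotient.mk J)).exists_ltSeries_length_eq_height
    rw [← hlen]
    let L : LTSeries (PrimeSpectrum A) := l.map (comap (Ideal.Quotient.mk J))
      (Monotone.strictMono_of_injective (fun _ _ h => Ideal.comap_mono h)
        (comap_injective_of_surjective _ Ideal.Quotient.mk_surjective))
    have hlast : L.last = ⟨m, hm.isPrime⟩ := by
      simp only [L, LTSeries.last_map, hl]
      refine PrimeSpectrum.ext ?_
      simp [Ideal.comap_map_of_surjective _ Ideal.Quotient.mk_surjective,
        ← RingHom.ker_eq_comap_bot, hJm]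
    have hhead : Q ≤ L.head := by
      have hJ : J ≤ L.head.asIdeal := by
        simp only [L, LTSeries.head_map]
        intro x hx
        simp [Ideal.Quotient.eq_zero_iff_mem.mpr hx]
      obtain ⟨P, hP, hPle⟩ := Ideal.exists_minimalPrimes_le hJ
      by_cases hPQ : P = Q.asIdeal
      · rw [hPQ] at hPle
        exact hPle
      · refine absurd (hPle (hgP P hP hPQ)) fun h => hgm ?_
        have : L.head ≤ L.last := LTSeries.head_le_last L
        rw [hlast] at this
        exact this h
    calc (l.length : ℕ∞) = L.length := rfl
      _ ≤ Order.coheight L.head := Order.length_le_coheight_head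
      _ ≤ Order.coheight Q := Order.coheight_anti hhead

/-- The dimension formula for finitely generated domains over a field. -/
theorem exists_ringKrullDim_eq_and_height_add_coheight_eq (F A : Type*) [Field F] [CommRing A]
    [IsDomain A] [Algebra F A] [Algebra.FiniteType F A] :
    ∃ d : ℕ, ringKrullDim A = d ∧
      ∀ Q : PrimeSpectrum A, Order.height Q + Order.coheight Q = d := by
  obtain ⟨d, φ, hinj, hint⟩ := exists_integral_inj_algHom_of_fg F A
  let := φ.toRingHom.toAlgebra
  have : Algebra.IsIntegral (MvPolynomial (Fin d) F) A := ⟨hint⟩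
  have hdim : ringKrullDim A = d := by
    rw [ringKrullDim_eq_of_isIntegral (S := MvPolynomial (Fin d) F) hinj]
    simp [MvPolynomial.ringKrullDim_of_isNoetherianRing]
  have : FaithfulSMul (MvPolynomial (Fin d) F) A := (faithfulSMul_iff_algebraMap_injective _ _).mpr hinj
  have : IsNoetherianRing A := Algebra.FiniteType.isNoetherianRing F A
  have : IsJacobsonRing A := isJacobsonRing_of_finiteType (A := F)
  refine ⟨d, hdim, height_add_coheight_eq_of_forall_isMaximal (fun m hm => ?_) hdim⟩
  refine le_antisymm ?_ ?_
  · have h := Ideal.height_le_ringKrullDim_of_ne_top hm.ne_top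
    rw [hdim] at h
    exact_mod_cast h
  -- Going down over the normal ring `F[X_1, …, X_d]`: the height of `m` is at least that of its
  -- contraction, a maximal ideal of height `d`.
  · have := height_eq_of_isMaximal_mvPolynomial F d (m.under _)
    rw [← this, Ideal.height_eq_height_add_of_liesOver_of_hasGoingDown (m.under
      (MvPolynomial (Fin d) F)) m]
    exact le_self_add

end SchubertInduction

/-! ### Ideals of height one in polynomial rings over normal domains -/

namespace SchubertInduction

open Polynomial

/-- The index produced is the first one at which the maximal value is attained; being first is what
isolates a dominant term in a product. -/
theorem exists_mem_isMax_valuation {F Γ : Type*} [Field F] [LinearOrderedCommGroupWithZero Γ]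
    (v : Valuation F Γ) (f : F[X]) :
    ∃ i, (∀ j, v (f.coeff j) ≤ v (f.coeff i)) ∧ ∀ j < i, v (f.coeff j) < v (f.coeff i) := by
  classical
  have hex : ∃ i, ∀ j, v (f.coeff j) ≤ v (f.coeff i) := by
    obtain ⟨i, -, hi⟩ := (Finset.range (f.natDegree + 1)).exists_max_image (fun i => v (f.coeff i))
      ⟨0, by simp⟩
    refine ⟨i, fun j => ?_⟩
    by_cases hj : j ∈ Finset.range (f.natDegree + 1)
    · exact hi j hj
    · rw [coeff_eq_zero_of_natDegree_lt (by simpa [Nat.lt_succ_iff] using hj), map_zero]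
      exact zero_le
  refine ⟨Nat.find hex, Nat.find_spec hex, fun j hj => ?_⟩
  have h := Nat.find_min hex hj
  push Not at h
  obtain ⟨k, hk⟩ := h
  exact hk.trans_le (Nat.find_spec hex k)

/-- Gauss's lemma for valuations. -/
theorem valuation_coeff_mul_coeff_le_one {F Γ : Type*} [Field F]
    [LinearOrderedCommGroupWithZero Γ] (v : Valuation F Γ) {f g : F[X]}
    (h : ∀ n, v ((f * g).coeff n) ≤ 1) (i j : ℕ) : v (f.coeff i * g.coeff j) ≤ 1 := by
  obtain ⟨a, ha, ha'⟩ := exists_mem_isMax_valuation v f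
  obtain ⟨b, hb, hb'⟩ := exists_mem_isMax_valuation v g
  have hle : v (f.coeff i * g.coeff j) ≤ v (f.coeff a * g.coeff b) := by
    rw [map_mul, map_mul]
    exact mul_le_mul' (ha i) (hb j)
  refine hle.trans ?_
  by_cases h0 : v (f.coeff a * g.coeff b) = 0
  · rw [h0]; exact zero_le_one
  have hfa : v (f.coeff a) ≠ 0 := by
    intro h; exact h0 (by rw [map_mul, h, zero_mul])
  have hgb : v (g.coeff b) ≠ 0 := by
    intro h; exact h0 (by rw [map_mul, h, mul_zero])
  -- In the coefficient of degree `a + b` every other term has a first index below `a` or a second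
  -- index below `b`, so the term at `(a, b)` strictly dominates.
  refine le_trans (le_of_eq ?_) (h (a + b))
  have hmem : (a, b) ∈ Finset.HasAntidiagonal.antidiagonal (a + b) := by simp
  rw [coeff_mul, ← Finset.add_sum_erase _ _ hmem]
  refine (v.map_add_eq_of_lt_left (v.map_sum_lt h0 fun x hx => ?_)).symm
  simp only [Finset.mem_erase, Finset.HasAntidiagonal.mem_antidiagonal] at hx
  have hx' : x.1 < a ∨ x.2 < b := by
    by_contra! hcon
    exact hx.1 (Prod.ext (by dsimp only; omega) (by dsimp only; omega))
  rw [map_mul, map_mul]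
  rcases hx' with hlt | hlt
  · exact mul_lt_mul_of_lt_of_le_of_nonneg_of_pos (ha' _ hlt) (hb _) zero_le (zero_lt_iff.mpr hgb)
  · rw [mul_comm, mul_comm (v (f.coeff a))]
    exact mul_lt_mul_of_lt_of_le_of_nonneg_of_pos (hb' _ hlt) (ha _) zero_le (zero_lt_iff.mpr hfa)

/-- Kronecker's theorem: over an integrally closed domain, if a product of two polynomials over the
fraction field is integral, then so are the products of their coefficients. -/
theorem coeff_mul_coeff_mem_range {L F : Type*} [CommRing L] [IsDomain L] [IsIntegrallyClosed L]
    [Field F] [Algebra L F] [IsFractionRing L F] {f g : F[X]}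
    (h : ∀ n, (f * g).coeff n ∈ (algebraMap L F).range) (i j : ℕ) :
    f.coeff i * g.coeff j ∈ (algebraMap L F).range := by
  have hint : IsIntegrallyClosedIn (algebraMap L F).range F := by
    rw [isIntegrallyClosedIn_iff]
    refine ⟨Subtype.val_injective, fun {x} hx => ?_⟩
    have hx' : IsIntegral L x := by
      obtain ⟨p, hp, hpx⟩ := hx
      have hs : Function.Surjective (algebraMap L F).rangeRestrict := RingHom.rangeRestrict_surjective _
      obtain ⟨p', hp', -, hmon⟩ := Polynomial.lifts_and_natDegree_eq_and_monic
        (Polynomial.map_surjective _ hs p) hp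
      refine ⟨p', hmon, ?_⟩
      rw [← hpx, ← hp', eval₂_map]
      rfl
    obtain ⟨y, hy⟩ := IsIntegrallyClosed.isIntegral_iff.mp hx'
    exact ⟨⟨x, y, hy⟩, rfl⟩
  -- An integrally closed subring of a field is the intersection of the valuation rings containing
  -- it, which reduces the claim to Gauss's lemma.
  rw [Subring.eq_iInf_of_isIntegrallyClosedIn (R := (algebraMap L F).range)]
  simp only [Subring.mem_iInf]
  rintro ⟨V, hV⟩
  exact (V.valuation_le_one_iff _).mp (valuation_coeff_mul_coeff_le_one V.valuation
    (fun n => (V.valuation_le_one_iff _).mpr (hV (h n))) i j)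

theorem exists_map_eq_of_forall_coeff_mem {L F : Type*} [CommRing L] [CommRing F] {φ : L →+* F}
    {f : F[X]} (h : ∀ n, f.coeff n ∈ φ.range) : ∃ g : L[X], g.map φ = f := by
  have : f ∈ Polynomial.lifts φ := (Polynomial.lifts_iff_coeff_lifts f).mpr h
  exact (Polynomial.mem_lifts f).mp this

/-- Let `L` be a normal local domain with maximal ideal `m`. A prime of height at most one of `L[X]`
that is not contained in `m[X]` is principal. -/
theorem exists_eq_span_singleton_of_not_le_map_C {L : Type*} [CommRing L] [IsDomain L]
    [IsLocalRing L] [IsIntegrallyClosed L] (P : Ideal L[X]) [P.IsPrime] (hht : P.height ≤ 1)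
    (hP : ¬ P ≤ (IsLocalRing.maximalIdeal L).map C) : ∃ f, P = Ideal.span {f} := by
  set m := IsLocalRing.maximalIdeal L
  -- Otherwise `0 ⊂ (P ∩ L)[X] ⊂ P` is a strict chain, the last inclusion because `P ⊈ m[X]`, and
  -- `P` has height at least two.
  have hcomap : P.comap C = ⊥ := by
    by_contra hne
    have hpr : (P.comap C).IsPrime := Ideal.comap_isPrime _ _
    have hpr' : ((P.comap C).map (C : L →+* L[X])).IsPrime := Ideal.isPrime_map_C_of_isPrime
    have hle : (P.comap C).map (C : L →+* L[X]) ≤ P := Ideal.map_comap_le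
    have hlt : (P.comap C).map (C : L →+* L[X]) < P := by
      refine lt_of_le_of_ne hle fun h => hP ?_
      rw [← h]
      exact Ideal.map_mono (IsLocalRing.le_maximalIdeal_of_isPrime _)
    have hbot : (⊥ : Ideal L[X]) < (P.comap C).map (C : L →+* L[X]) := by
      rw [bot_lt_iff_ne_bot]
      intro h
      rw [Ideal.map_eq_bot_iff_of_injective C_injective] at h
      exact hne h
    have h1 := Ideal.height_add_one_le_of_lt_of_isPrime hbot
    have h2 := Ideal.height_add_one_le_of_lt_of_isPrime hlt
    have h3 : (1 : ℕ∞) + 1 ≤ 1 := (add_le_add_left (le_trans le_add_self h1) 1).trans (h2.trans hht)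
    exact absurd h3 (by decide)
  let F := FractionRing L
  let φ := algebraMap L F
  have hφ : Function.Injective φ := IsFractionRing.injective L F
  have hmap : Function.Injective (mapRingHom φ) := Polynomial.map_injective φ hφ
  have hloc {x : L[X]} (hx : mapRingHom φ x ∈ P.map (mapRingHom φ)) : x ∈ P := by
    let _ : Algebra L[X] F[X] := Polynomial.algebra _ _
    have : IsLocalization ((nonZeroDivisors L).map (C : L →+* L[X])) F[X] :=
      Polynomial.isLocalization (nonZeroDivisors L) F
    have hx' : algebraMap L[X] F[X] x ∈ P.map (algebraMap L[X] F[X]) := hx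
    rw [IsLocalization.algebraMap_mem_map_algebraMap_iff
      ((nonZeroDivisors L).map (C : L →+* L[X]))] at hx'
    obtain ⟨_, ⟨s, hs, rfl⟩, h⟩ := hx'
    refine (Ideal.IsPrime.mem_or_mem ‹P.IsPrime› h).resolve_left fun hCs => ?_
    have : s ∈ P.comap C := hCs
    rw [hcomap, Ideal.mem_bot] at this
    exact nonZeroDivisors.ne_zero hs this
  obtain ⟨f, hf⟩ := (IsPrincipalIdealRing.principal (P.map (mapRingHom φ))).principal
  replace hf : P.map (mapRingHom φ) = Ideal.span {f} := hf
  have hfac (x : L[X]) (hx : x ∈ P) : ∃ h, mapRingHom φ x = f * h := by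
    have := Ideal.mem_map_of_mem (mapRingHom φ) hx
    rw [hf, Ideal.mem_span_singleton] at this
    exact this
  obtain ⟨g, hgP, hg⟩ := SetLike.not_le_iff_exists.mp hP
  rw [Ideal.mem_map_C_iff] at hg
  push Not at hg
  obtain ⟨n, hn⟩ := hg
  obtain ⟨h, hh⟩ := hfac g hgP
  have hK := coeff_mul_coeff_mem_range (L := L) (F := F) (f := f) (g := h)
    (fun k => ⟨g.coeff k, by rw [← hh]; simp [φ]⟩)
  -- Write `g = f h` over the fraction field. All products of a coefficient of `f` and one of `h`
  -- lie in `L`; were none a unit, every coefficient of `g` would lie in `m`.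
  obtain ⟨a, b, u, hu, hab⟩ : ∃ a b, ∃ u : L, IsUnit u ∧ φ u = f.coeff a * h.coeff b := by
    choose c hc using hK
    by_contra! hcon
    have hcm (i j) : c i j ∈ m := by
      by_contra hnot
      exact hcon i j (c i j) (by simpa [m] using hnot) (hc i j)
    apply hn
    have : g.coeff n = ∑ x ∈ Finset.HasAntidiagonal.antidiagonal n, c x.1 x.2 := by
      apply hφ
      rw [map_sum, ← Polynomial.coeff_map, ← Polynomial.coe_mapRingHom, hh, coeff_mul]
      exact Finset.sum_congr rfl fun x _ => (hc _ _).symm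
    rw [this]
    exact sum_mem fun x _ => hcm _ _
  obtain ⟨f', hf'⟩ := exists_map_eq_of_forall_coeff_mem (φ := φ) (f := f * C (h.coeff b))
    (fun k => by rw [coeff_mul_C]; exact hK k b)
  have hb0 : h.coeff b ≠ 0 := by
    intro h0
    rw [h0, mul_zero] at hab
    exact hu.ne_zero (hφ (by rw [hab, map_zero]))
  have hf'a : f'.coeff a = u := hφ (by rw [← Polynomial.coeff_map, hf', coeff_mul_C, hab])
  have hf'P : f' ∈ P := by
    apply hloc
    rw [hf, coe_mapRingHom, hf']
    exact Ideal.mul_mem_right _ _ (Ideal.mem_span_singleton_self f)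
  -- The generator is `f' = h_b f`, whose coefficient at `a` is a unit. If `x = f' k` over the
  -- fraction field, Kronecker's theorem puts `f'_a k_n` in `L`, hence every `k_n`.
  refine ⟨f', le_antisymm (fun x hx => ?_) (by simpa [Ideal.span_le] using hf'P)⟩
  obtain ⟨k, hk⟩ := hfac x hx
  have hk' : mapRingHom φ x = f'.map φ * (C (h.coeff b)⁻¹ * k) := by
    rw [hk, hf', mul_assoc, ← mul_assoc (C _) (C _), ← C_mul, mul_inv_cancel₀ hb0, C_1, one_mul]
  have hK' := coeff_mul_coeff_mem_range (L := L) (F := F) (f := f'.map φ)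
    (g := C (h.coeff b)⁻¹ * k) (fun n => ⟨x.coeff n, by rw [← hk']; simp [φ]⟩)
  obtain ⟨k', hk'e⟩ := exists_map_eq_of_forall_coeff_mem (φ := φ) (f := C (h.coeff b)⁻¹ * k)
    (fun n => by
      obtain ⟨y, hy⟩ := hK' a n
      rw [coeff_map, hf'a] at hy
      obtain ⟨v, hv⟩ := hu.exists_left_inv
      refine ⟨v * y, ?_⟩
      rw [map_mul]
      change φ v * algebraMap L F y = _
      rw [hy, ← mul_assoc, ← map_mul, hv, map_one, one_mul])
  rw [Ideal.mem_span_singleton]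
  refine ⟨k', hmap ?_⟩
  rw [map_mul, hk', coe_mapRingHom, hk'e]

/-- A prime `P` of height at most one of `A[X]` with `P ∩ A ⊆ q` and `P ⊈ q[X]` is principal
locally at `q`, if the local ring at `q` is normal. -/
theorem exists_mem_forall_le_of_not_le_map_C {A : Type*} [CommRing A] [IsDomain A] (q : Ideal A)
    [q.IsPrime] [IsIntegrallyClosed (Localization.AtPrime q)] (P : Ideal A[X]) [P.IsPrime]
    (hht : P.height ≤ 1) (hcomap : P.comap C ≤ q) (hP : ¬ P ≤ q.map C) :
    ∃ f ∈ P, ∀ Q : Ideal A[X], Q.IsPrime → Q.comap C ≤ q → f ∈ Q → P ≤ Q := by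
  let L := Localization.AtPrime q
  let _ : Algebra A[X] L[X] := Polynomial.algebra _ _
  have : IsLocalization (q.primeCompl.map (C : A →+* A[X])) L[X] :=
    Polynomial.isLocalization q.primeCompl L
  have hdisj : Disjoint (q.primeCompl.map (C : A →+* A[X]) : Set A[X]) P := by
    rw [Set.disjoint_left]
    rintro _ ⟨s, hs, rfl⟩ h
    exact hs (hcomap h)
  have hprime := IsLocalization.isPrime_of_isPrime_disjoint
    (q.primeCompl.map (C : A →+* A[X])) L[X] P ‹_› hdisj
  have hheight : (P.map (algebraMap A[X] L[X])).height ≤ 1 := by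
    rwa [IsLocalization.height_map_of_disjoint (q.primeCompl.map (C : A →+* A[X])) P hdisj]
  have hnot : ¬ P.map (algebraMap A[X] L[X]) ≤ (IsLocalRing.maximalIdeal L).map C := by
    intro h
    apply hP
    intro x hx
    have h1 := h (Ideal.mem_map_of_mem _ hx)
    rw [Ideal.mem_map_C_iff] at h1 ⊢
    intro n
    have h2 := h1 n
    have h3 : (algebraMap A[X] L[X] x).coeff n = algebraMap A L (x.coeff n) :=
      Polynomial.coeff_map _ _
    rw [h3] at h2
    exact (IsLocalization.AtPrime.to_map_mem_maximal_iff L q _).mp h2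
  obtain ⟨f', hf'⟩ := exists_eq_span_singleton_of_not_le_map_C _ hheight hnot
  have hmem : f' ∈ P.map (algebraMap A[X] L[X]) := hf' ▸ Ideal.mem_span_singleton_self f'
  obtain ⟨⟨⟨a, haP⟩, s⟩, hs⟩ := (IsLocalization.mem_map_algebraMap_iff
    (q.primeCompl.map (C : A →+* A[X])) L[X]).mp hmem
  refine ⟨a, haP, fun Q hQ hQq haQ x hx => ?_⟩
  have hCQ (t : q.primeCompl.map (C : A →+* A[X])) : (t : A[X]) ∉ Q := by
    obtain ⟨_, t, ht, rfl⟩ := t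
    exact fun h => ht (hQq h)
  have hx' := Ideal.mem_map_of_mem (algebraMap A[X] L[X]) hx
  rw [hf', Ideal.mem_span_singleton] at hx'
  obtain ⟨y, hy⟩ := hx'
  obtain ⟨⟨b, t⟩, ht⟩ := IsLocalization.surj (q.primeCompl.map (C : A →+* A[X])) y
  have heq : algebraMap A[X] L[X] (x * s * t) = algebraMap A[X] L[X] (a * b) := by
    simp only [map_mul, ← ht, hy]
    dsimp only at hs
    rw [← hs]
    ring
  obtain ⟨c, hc⟩ := (IsLocalization.eq_iff_exists (q.primeCompl.map (C : A →+* A[X])) _).mp heq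
  have h1 : (c : A[X]) * (x * s * t) ∈ Q := hc ▸ Q.mul_mem_left _ (Q.mul_mem_right _ haQ)
  have h2 := (hQ.mem_or_mem h1).resolve_left (hCQ c)
  have h3 := (hQ.mem_or_mem h2).resolve_right (hCQ t)
  exact (hQ.mem_or_mem h3).resolve_right (hCQ s)

/-- If all minimal primes over `I ⊆ A[X]` have height at most one and `I ⊈ q[X]`, then the
closed subset defined by `I` is locally at `q` defined by one equation. -/
theorem exists_mem_forall_le_of_height_minimalPrimes_le_one {A : Type*} [CommRing A] [IsDomain A]
    [IsNoetherianRing A] {I : Ideal A[X]} (hI : ∀ P ∈ I.minimalPrimes, P.height ≤ 1)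
    (q : Ideal A) [q.IsPrime] [IsIntegrallyClosed (Localization.AtPrime q)]
    (hIq : ¬ I ≤ q.map C) (Q : Ideal A[X]) [Q.IsPrime] (hIQ : I ≤ Q) (hQ : Q.comap C = q) :
    ∃ f ∈ Q, ∀ Q' : Ideal A[X], Q'.IsPrime → Q' ≤ Q → f ∈ Q' → I ≤ Q' := by
  classical
  have key (P : Ideal A[X]) (hP : P ∈ I.minimalPrimes) (hPQ : P ≤ Q) :
      ∃ f ∈ P, ∀ Q' : Ideal A[X], Q'.IsPrime → Q'.comap C ≤ q → f ∈ Q' → P ≤ Q' := by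
    have := hP.1.1
    exact exists_mem_forall_le_of_not_le_map_C q P (hI P hP) (hQ ▸ Ideal.comap_mono hPQ)
      fun h => hIq (hP.1.2.trans h)
  choose! c hc hc' using key
  have hfin : I.minimalPrimes.Finite := I.finite_minimalPrimes_of_isNoetherianRing
  -- Only the components through `Q` contribute: their local equations are multiplied.
  refine ⟨∏ P ∈ hfin.toFinset.filter (· ≤ Q), c P, ?_, fun Q' hQ' hle h => ?_⟩
  · obtain ⟨P, hP, hPQ⟩ := Ideal.exists_minimalPrimes_le hIQ
    exact Ideal.mem_of_dvd _ (Finset.dvd_prod_of_mem _ (by simp [hP, hPQ])) (hPQ (hc P hP hPQ))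
  · rw [hQ'.prod_mem_iff] at h
    obtain ⟨P, hP, hPQ'⟩ := h
    simp only [Finset.mem_filter, Set.Finite.mem_toFinset] at hP
    exact hP.1.1.2.trans (hc' P hP.1 hP.2 Q' hQ' (hQ ▸ Ideal.comap_mono hle) hPQ')

end SchubertInduction

/-! ### Intersections in the affine charts -/

namespace SchubertInduction

open PrimeSpectrum nonZeroDivisors

attribute [local instance] MvPolynomial.algebraMvPolynomial

section GenericFiberOfAffineSpace

variable (K C σ : Type u) [Field K] [CommRing C] [Algebra K C]

instance finiteType_mvPolynomial_mvPolynomial [Algebra.FiniteType K C] [Finite σ] :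
    Algebra.FiniteType (MvPolynomial σ K) (MvPolynomial σ C) := by
  have : Algebra.FiniteType K (MvPolynomial σ C) :=
    Algebra.FiniteType.trans (S := C) inferInstance inferInstance
  exact Algebra.FiniteType.of_restrictScalars_finiteType K _ _

/-- A Noether normalization of `C` stays injective and integral after the variables `σ` are
adjoined, so the generic fibre has the dimension of that of affine `n`-space. -/
theorem krullDim_genericFiber_mvPolynomial [Algebra.FiniteType K C] [Nontrivial C] [Finite σ] :
    Order.krullDim (comap (algebraMap (MvPolynomial σ K) (MvPolynomial σ C)) ⁻¹'
      {⟨⊥, Ideal.isPrime_bot⟩}) = ringKrullDim C := by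
  obtain ⟨n, φ, hinj, hint⟩ := exists_integral_inj_algHom_of_fg K C
  let e := MvPolynomial.commAlgEquiv K (Fin n) σ
  let θ : MvPolynomial (Fin n) (MvPolynomial σ K) →+* MvPolynomial σ C :=
    (MvPolynomial.map φ.toRingHom).comp e.toRingEquiv.toRingHom
  have hθinj : Function.Injective θ := (MvPolynomial.map_injective _ hinj).comp e.injective
  have hθint : θ.IsIntegral := by
    refine RingHom.IsIntegral.trans _ _ (RingHom.isIntegral_of_surjective _ e.surjective) ?_
    let _ := φ.toRingHom.toAlgebra
    intro x
    exact MvPolynomial.isIntegral_iff_isIntegral_coeff.mpr fun m => hint _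
  have hθ : θ.comp (algebraMap (MvPolynomial σ K) _) =
      algebraMap (MvPolynomial σ K) (MvPolynomial σ C) := by
    rw [MvPolynomial.algebraMap_def]
    apply MvPolynomial.ringHom_ext
    · intro r
      simp [θ, e]
    · intro i
      simp [θ, e]
  let _ := θ.toAlgebra
  let _ := φ.toRingHom.toAlgebra
  have : IsScalarTower (MvPolynomial σ K) (MvPolynomial (Fin n) (MvPolynomial σ K))
      (MvPolynomial σ C) := .of_algebraMap_eq' hθ.symm
  have : Algebra.IsIntegral (MvPolynomial (Fin n) (MvPolynomial σ K)) (MvPolynomial σ C) := ⟨hθint⟩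
  have : Algebra.IsIntegral (MvPolynomial (Fin n) K) C := ⟨hint⟩
  rw [krullDim_fiber_eq_of_isIntegral (S := MvPolynomial (Fin n) (MvPolynomial σ K)) hθinj,
    krullDim_fiber_mvPolynomial, ringKrullDim_eq_of_isIntegral (S := MvPolynomial (Fin n) K) hinj]
  simp [MvPolynomial.ringKrullDim_of_isNoetherianRing]

/-- The dimension formula in the generic fibre of affine space over `C`. -/
theorem height_add_coheight_genericFiber [Algebra.FiniteType K C] [IsDomain C] [Finite σ] :
    ∃ d : ℕ, ringKrullDim C = d ∧
      ∀ Q : comap (algebraMap (MvPolynomial σ K) (MvPolynomial σ C)) ⁻¹'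
        {⟨⊥, Ideal.isPrime_bot⟩}, Order.height Q.1 + Order.coheight Q = d := by
  set R := MvPolynomial σ K
  set S := MvPolynomial σ C
  set G := comap (algebraMap R S) ⁻¹' {⟨⊥, Ideal.isPrime_bot⟩}
  have hinj : Function.Injective (algebraMap R S) :=
    MvPolynomial.map_injective _ (algebraMap K C).injective
  have : IsDomain (GenericFiber R S) := IsLocalization.isDomain_localization
    (map_le_nonZeroDivisors_of_injective _ hinj le_rfl)
  obtain ⟨d, hd, hQ⟩ := exists_ringKrullDim_eq_and_height_add_coheight_eq (FractionRing R)
    (GenericFiber R S)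
  have hset : {p : PrimeSpectrum S | Disjoint (Algebra.algebraMapSubmonoid S R⁰ : Set S)
      p.asIdeal} = G := by
    ext Q
    constructor
    · intro h
      refine PrimeSpectrum.ext (le_antisymm (fun r hr => ?_) bot_le)
      by_contra hne
      exact Set.disjoint_left.mp h ⟨r, mem_nonZeroDivisors_of_ne_zero hne, rfl⟩ hr
    · rintro h
      change Disjoint _ _
      rw [Set.disjoint_left]
      rintro _ ⟨r, hr, rfl⟩ hrQ
      have h1 : r ∈ (comap (algebraMap R S) Q).asIdeal := hrQ
      rw [show comap (algebraMap R S) Q = _ from h] at h1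
      exact nonZeroDivisors.ne_zero hr h1
  let e : PrimeSpectrum (GenericFiber R S) ≃o G :=
    (IsLocalization.primeSpectrumOrderIso (Algebra.algebraMapSubmonoid S R⁰)
      (GenericFiber R S)).trans (OrderIso.setCongr _ _ hset)
  refine ⟨d, ?_, fun Q => ?_⟩
  · rw [← krullDim_genericFiber_mvPolynomial K C σ, ← hd]
    exact (Order.krullDim_eq_of_orderIso e).symm
  -- A prime below one that contracts to zero also contracts to zero, so heights in the generic
  -- fibre and in the whole spectrum agree.
  · have h1 : Order.height Q = Order.height Q.1 := by
      refine Order.height_eq_of_strictMono Subtype.val (Subtype.strictMono_coe _) ?_ Q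
      rintro ⟨Q, hQ⟩ Q' hlt
      refine ⟨⟨Q', PrimeSpectrum.ext (le_antisymm ?_ bot_le)⟩, hlt, rfl⟩
      rw [← show comap (algebraMap R S) Q = _ from hQ]
      exact Ideal.comap_mono hlt.le
    rw [← h1, ← e.apply_symm_apply Q, Order.height_orderIso, Order.coheight_orderIso]
    exact hQ _

end GenericFiberOfAffineSpace

section FiberOfClosed

variable {R S : Type u} [CommRing R] [IsDomain R] [CommRing S] [Algebra R S]

/-- The set is order isomorphic to the fibre of `S ⧸ J`, for which generic constancy is known. -/
theorem exists_krullDim_fiber_inter_zeroLocus_eq [Algebra.FiniteType R S] (J : Ideal S) :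
    ∃ g : R, g ≠ 0 ∧ ∀ s : PrimeSpectrum R, g ∉ s.asIdeal →
      Order.krullDim ↥(comap (algebraMap R S) ⁻¹' {s} ∩ zeroLocus (J : Set S)) =
      Order.krullDim ↥(comap (algebraMap R S) ⁻¹' {⟨⊥, Ideal.isPrime_bot⟩} ∩
        zeroLocus (J : Set S)) := by
  have : Algebra.FiniteType R (S ⧸ J) := Algebra.FiniteType.trans (S := S) inferInstance inferInstance
  obtain ⟨g, hg, hfib⟩ := exists_krullDim_fiber_eq R (S ⧸ J)
  refine ⟨g, hg, fun s hs => ?_⟩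
  have key (t : PrimeSpectrum R) : Order.krullDim
      ↥(comap (algebraMap R S) ⁻¹' {t} ∩ zeroLocus (J : Set S)) =
      Order.krullDim ↥(comap (algebraMap R (S ⧸ J)) ⁻¹' {t}) := by
    symm
    let e : comap (algebraMap R (S ⧸ J)) ⁻¹' {t} →
        ↥(comap (algebraMap R S) ⁻¹' {t} ∩ zeroLocus (J : Set S)) :=
      fun Q => ⟨comap (Ideal.Quotient.mk J) Q.1, Q.2, fun x hx => by
        change Ideal.Quotient.mk J x ∈ Q.1.asIdeal
        rw [Ideal.Quotient.eq_zero_iff_mem.mpr hx]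
        exact zero_mem _⟩
    have hle (a b) : e a ≤ e b ↔ a ≤ b := by
      refine ⟨fun h x hx => ?_, fun h => Ideal.comap_mono h⟩
      obtain ⟨x, rfl⟩ := Ideal.Quotient.mk_surjective x
      exact h hx
    have hsurj : Function.Surjective e := by
      rintro ⟨Q, hQ, hJ⟩
      have hr : Q ∈ Set.range (comap (Ideal.Quotient.mk J)) := by
        rw [range_comap_of_surjective _ _ Ideal.Quotient.mk_surjective, Ideal.mk_ker]
        exact hJ
      obtain ⟨Q', rfl⟩ := hr
      exact ⟨⟨Q', hQ⟩, rfl⟩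
    exact Order.krullDim_eq_of_orderIso (RelIso.ofSurjective (OrderEmbedding.ofMapLEIff e hle) hsurj)
  rw [key, key, hfib s hs]

end FiberOfClosed

/-! ### Heights of the primes containing the equations of all the families -/

section Chart

theorem eval₂RingHom_C_X_injective {σ : Type*} (D : Type*) [CommRing D] (i : σ) :
    Function.Injective (Polynomial.eval₂RingHom (MvPolynomial.C (R := D)) (MvPolynomial.X i)) := by
  refine Function.LeftInverse.injective (g := MvPolynomial.eval₂Hom
    (Polynomial.C (R := D)) fun _ : σ => Polynomial.X) fun x => ?_
  have : (MvPolynomial.eval₂Hom (Polynomial.C (R := D))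
      fun _ : σ => Polynomial.X).comp
      (Polynomial.eval₂RingHom (MvPolynomial.C (R := D))
        (MvPolynomial.X i)) = RingHom.id _ := by
    apply Polynomial.ringHom_ext
    · intro a; simp
    · simp
  exact DFunLike.congr_fun this x

variable {K A σ : Type u} [Field K] [CommRing A] [Algebra K A] (p : Ideal A)

/-- The map `A[X] → (A/p)[X_i | i ∈ σ]` sending `X` to `X_i`. -/
noncomputable def toVariable (i : σ) : Polynomial A →+* MvPolynomial σ (A ⧸ p) :=
  Polynomial.eval₂RingHom (MvPolynomial.C.comp (Ideal.Quotient.mk p)) (MvPolynomial.X i)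

/-- The ideal generated by the `I i`, with the variable of `I i` being the `i`-th one. -/
noncomputable def chartIdeal (I : σ → Ideal (Polynomial A)) : Ideal (MvPolynomial σ (A ⧸ p)) :=
  ⨆ i, (I i).map (toVariable p i)

/-- Kernels of the maps specializing the variables in `s` to their values modulo `Q`. -/
noncomputable def specialize {C : Type u} [CommRing C] (Q : Ideal (MvPolynomial σ C))
    [DecidableEq σ] (s : Finset σ) :
    MvPolynomial σ C →+* MvPolynomial σ (MvPolynomial σ C ⧸ Q) :=
  MvPolynomial.eval₂Hom (MvPolynomial.C.comp ((Ideal.Quotient.mk Q).comp MvPolynomial.C))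
    fun i => if i ∈ s then .C (Ideal.Quotient.mk Q (.X i)) else .X i

/-- Once `X_i` is specialized, the elements of `I i` become constants, and these vanish when they
come from `Q`. -/
theorem specialize_comp_toVariable [DecidableEq σ] (Q : Ideal (MvPolynomial σ (A ⧸ p)))
    {s : Finset σ} {i : σ} (hi : i ∈ s) :
    (specialize Q s).comp (toVariable p i) =
      MvPolynomial.C.comp ((Ideal.Quotient.mk Q).comp (toVariable p i)) := by
  apply Polynomial.ringHom_ext
  · intro a
    simp [specialize, toVariable]
  · simp [specialize, toVariable, hi]

/-- While `X_i` is still free, `f` becomes a polynomial in `X_i` whose coefficients are those of `f`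
modulo `Q`; one of them is non-zero. -/
theorem specialize_toVariable_ne_zero [DecidableEq σ] (Q : Ideal (MvPolynomial σ (A ⧸ p)))
    {s : Finset σ} {i : σ} (hi : i ∉ s) {f : Polynomial A}
    (hf : f ∉ ((Q.comap MvPolynomial.C).comap (Ideal.Quotient.mk p)).map Polynomial.C) :
    specialize Q s (toVariable p i f) ≠ 0 := by
  rw [Ideal.mem_map_C_iff] at hf
  obtain ⟨n, hn⟩ := not_forall.mp hf
  intro h
  apply hn
  have hcomp : (specialize Q s).comp (toVariable p i) = (Polynomial.eval₂RingHom MvPolynomial.C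
      (MvPolynomial.X i)).comp (Polynomial.mapRingHom
        (((Ideal.Quotient.mk Q).comp MvPolynomial.C).comp (Ideal.Quotient.mk p))) := by
    apply Polynomial.ringHom_ext
    · intro a
      simp [specialize, toVariable]
    · simp [specialize, toVariable, hi]
  have h1 := DFunLike.congr_fun hcomp f
  simp only [RingHom.comp_apply, h] at h1
  have hinj := eval₂RingHom_C_X_injective (MvPolynomial σ (A ⧸ p) ⧸ Q) i
  have h2 := (map_eq_zero_iff _ hinj).mp h1.symm
  have h3 := congrArg (fun g => Polynomial.coeff g n) h2
  simp only [Polynomial.coe_mapRingHom, Polynomial.coeff_map, Polynomial.coeff_zero,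
    RingHom.comp_apply] at h3
  rw [Ideal.Quotient.eq_zero_iff_mem] at h3
  exact h3

/-- The kernels of `specialize Q s` form a chain of primes as `s` grows from `∅` to the full set,
where the kernel is `Q`. Adding `i` to `s` enlarges the kernel strictly: an element of `I i` outside
`q[X]`, with `q` the contraction of `Q` to `A`, is killed only once `X_i` is specialized. -/
theorem card_le_height_of_chartIdeal_le [Fintype σ] {I : σ → Ideal (Polynomial A)}
    (hI : ∀ i, ∀ q : Ideal A, q.IsPrime → ¬ I i ≤ q.map Polynomial.C)
    (Q : Ideal (MvPolynomial σ (A ⧸ p))) [Q.IsPrime] (hQ : chartIdeal p I ≤ Q) :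
    (Fintype.card σ : ℕ∞) ≤ Q.height := by
  classical
  have hprime (s : Finset σ) : (RingHom.ker (specialize Q s)).IsPrime := RingHom.ker_isPrime _
  have hmono (s : Finset σ) (i : σ) : RingHom.ker (specialize Q s) ≤
      RingHom.ker (specialize Q (insert i s)) := by
    have hcomp : specialize Q (insert i s) = (MvPolynomial.eval₂Hom MvPolynomial.C fun j =>
        if j ∈ insert i s then .C (Ideal.Quotient.mk Q (.X j)) else .X j).comp
          (specialize Q s) := by
      apply MvPolynomial.ringHom_ext
      · intro a
        simp [specialize]
      · intro j
        by_cases hj : j ∈ s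
        · simp [specialize, hj]
        · simp [specialize, hj]
    intro x hx
    rw [RingHom.mem_ker] at hx ⊢
    rw [hcomp, RingHom.comp_apply, hx, map_zero]
  have hlt (s : Finset σ) (i : σ) (hi : i ∉ s) : RingHom.ker (specialize Q s) <
      RingHom.ker (specialize Q (insert i s)) := by
    refine lt_of_le_of_ne (hmono s i) fun heq => ?_
    obtain ⟨f, hf, hfq⟩ := SetLike.not_le_iff_exists.mp
      (hI i ((Q.comap MvPolynomial.C).comap (Ideal.Quotient.mk p)) inferInstance)
    refine specialize_toVariable_ne_zero p Q hi hfq ?_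
    rw [← RingHom.mem_ker, heq, RingHom.mem_ker, ← RingHom.comp_apply,
      specialize_comp_toVariable p Q (Finset.mem_insert_self i s)]
    have : toVariable p i f ∈ Q := hQ (le_iSup (fun i => (I i).map (toVariable p i)) i
      (Ideal.mem_map_of_mem _ hf))
    simp [Ideal.Quotient.eq_zero_iff_mem.mpr this]
  have hcard (s : Finset σ) : (s.card : ℕ∞) ≤ (RingHom.ker (specialize Q s)).height := by
    induction s using Finset.induction_on with
    | empty => simp
    | insert i s hi ih =>
      rw [Finset.card_insert_of_notMem hi]
      push_cast
      exact (add_le_add_left ih 1).trans (Ideal.height_add_one_le_of_lt_of_isPrime (hlt s i hi))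
  have huniv : RingHom.ker (specialize Q Finset.univ) = Q := by
    have : specialize Q Finset.univ = MvPolynomial.C.comp (Ideal.Quotient.mk Q) := by
      apply MvPolynomial.ringHom_ext
      · intro a
        simp [specialize]
      · intro j
        simp [specialize]
    ext x
    rw [RingHom.mem_ker, this, RingHom.comp_apply, MvPolynomial.C_eq_zero,
      Ideal.Quotient.eq_zero_iff_mem]
  have := hcard Finset.univ
  rwa [huniv] at this

/-- Normality at the contraction of `Q` provides one equation `f i` for each `I i`, valid for all
primes below `Q`. So `Q` is minimal over `card σ` elements, and Krull's height theorem applies. -/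
theorem height_le_card_of_mem_minimalPrimes_chartIdeal [IsDomain A] [IsNoetherianRing A]
    [Fintype σ] {I : σ → Ideal (Polynomial A)}
    (hI : ∀ i, ∀ q : Ideal A, q.IsPrime → ¬ I i ≤ q.map Polynomial.C)
    (hht : ∀ i, ∀ P ∈ (I i).minimalPrimes, P.height ≤ 1)
    (hA : ∀ (q : Ideal A) [q.IsPrime], IsIntegrallyClosed (Localization.AtPrime q))
    (Q : Ideal (MvPolynomial σ (A ⧸ p))) (hQ : Q ∈ (chartIdeal p I).minimalPrimes) :
    Q.height ≤ Fintype.card σ := by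
  have := hQ.1.1
  set q := (Q.comap MvPolynomial.C).comap (Ideal.Quotient.mk p)
  have hle (i : σ) : I i ≤ Q.comap (toVariable p i) :=
    Ideal.map_le_iff_le_comap.mp ((le_iSup (fun i => (I i).map (toVariable p i)) i).trans hQ.1.2)
  have hcomap (Q' : Ideal (MvPolynomial σ (A ⧸ p))) (i : σ) :
      (Q'.comap (toVariable p i)).comap Polynomial.C =
        (Q'.comap MvPolynomial.C).comap (Ideal.Quotient.mk p) := by
    ext a
    simp [toVariable]
  have := hA q
  choose f hf hf' using fun i => exists_mem_forall_le_of_height_minimalPrimes_le_one (hht i) q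
    (hI i q inferInstance) (Q.comap (toVariable p i)) (hle i) (hcomap Q i)
  have hmin : Q ∈ (Ideal.span (Set.range fun i => toVariable p i (f i))).minimalPrimes := by
    refine ⟨⟨inferInstance, ?_⟩, fun Q' ⟨hQ', hle'⟩ hQ'Q => hQ.2 ⟨hQ', ?_⟩ hQ'Q⟩
    · rw [Ideal.span_le]
      rintro _ ⟨i, rfl⟩
      exact hf i
    · refine iSup_le fun i => Ideal.map_le_iff_le_comap.mpr ?_
      exact hf' i _ inferInstance (Ideal.comap_mono hQ'Q)
        (hle' (Ideal.subset_span ⟨i, rfl⟩))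
  refine (Ideal.height_le_card_of_mem_minimalPrimes_span (Set.finite_range _) hmin).trans ?_
  have : (Set.range fun i => toVariable p i (f i)).ncard ≤ Fintype.card σ := by
    rw [← Set.image_univ, ← Nat.card_eq_fintype_card, ← Set.ncard_univ]
    exact Set.ncard_image_le
  exact_mod_cast this

/-- Over a non-empty open subset of affine space, the common zero locus of the `I i` in the chart
`Spec (A/p)` is empty or has codimension `card σ`. -/
theorem exists_krullDim_fiber_chart [IsDomain A] [Algebra.FiniteType K A] [p.IsPrime]
    [Fintype σ] {I : σ → Ideal (Polynomial A)}
    (hI : ∀ i, ∀ q : Ideal A, q.IsPrime → ¬ I i ≤ q.map Polynomial.C)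
    (hht : ∀ i, ∀ P ∈ (I i).minimalPrimes, P.height ≤ 1)
    (hA : ∀ (q : Ideal A) [q.IsPrime], IsIntegrallyClosed (Localization.AtPrime q)) :
    ∃ g : MvPolynomial σ K, g ≠ 0 ∧ ∀ s : PrimeSpectrum (MvPolynomial σ K), g ∉ s.asIdeal →
      IsEmpty ↥(comap (algebraMap (MvPolynomial σ K) (MvPolynomial σ (A ⧸ p))) ⁻¹' {s} ∩
        zeroLocus (chartIdeal p I : Set (MvPolynomial σ (A ⧸ p)))) ∨
      Order.krullDim ↥(comap (algebraMap (MvPolynomial σ K) (MvPolynomial σ (A ⧸ p))) ⁻¹' {s} ∩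
        zeroLocus (chartIdeal p I : Set (MvPolynomial σ (A ⧸ p)))) + (Fintype.card σ : ℕ) =
          ringKrullDim (A ⧸ p) := by
  have : IsNoetherianRing A := Algebra.FiniteType.isNoetherianRing K A
  obtain ⟨d, hd, hQ⟩ := height_add_coheight_genericFiber K (A ⧸ p) σ
  obtain ⟨g, hg, hfib⟩ := exists_krullDim_fiber_inter_zeroLocus_eq (R := MvPolynomial σ K)
    (chartIdeal p I)
  refine ⟨g, hg, fun s hs => ?_⟩
  rw [← Order.krullDim_eq_bot_iff, hfib s hs, hd, Order.krullDim_eq_bot_iff]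
  clear hfib hs s
  set G := comap (algebraMap (MvPolynomial σ K) (MvPolynomial σ (A ⧸ p))) ⁻¹'
    {⟨⊥, Ideal.isPrime_bot⟩} with hG
  set Z := G ∩ zeroLocus (chartIdeal p I : Set (MvPolynomial σ (A ⧸ p))) with hZ
  let j : Z → G := fun Q => ⟨Q.1, Q.2.1⟩
  have hj : StrictMono j := fun Q Q' h => h
  -- `Z` is closed upwards in the generic fibre.
  have hco (Q : Z) : Order.coheight Q = Order.coheight (j Q) := by
    refine Order.coheight_eq_of_strictMono j hj ?_ Q
    intro Q Q' hlt
    exact ⟨⟨Q'.1, Q'.2, Set.Subset.trans Q.2.2 (le_of_lt hlt)⟩, hlt, rfl⟩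
  by_cases hemp : IsEmpty Z
  · exact .inl hemp
  right
  rw [not_isEmpty_iff] at hemp
  have hht1 (Q : Z) : (Fintype.card σ : ℕ∞) ≤ Order.height (j Q).1 := by
    rw [← PrimeSpectrum.height_eq_orderHeight]
    exact card_le_height_of_chartIdeal_le p hI _ Q.2.2
  obtain ⟨Q0, hQ0⟩ : ∃ Q0 : Z, Order.height (j Q0).1 = Fintype.card σ := by
    obtain ⟨Q⟩ := hemp
    have := Q.1.2
    obtain ⟨P, hP, hPQ⟩ := Ideal.exists_minimalPrimes_le
      (show chartIdeal p I ≤ Q.1.asIdeal from Q.2.2)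
    have hPG : (⟨P, hP.1.1⟩ : PrimeSpectrum (MvPolynomial σ (A ⧸ p))) ∈ G := by
      refine PrimeSpectrum.ext (le_antisymm ?_ bot_le)
      rw [← show comap (algebraMap (MvPolynomial σ K) (MvPolynomial σ (A ⧸ p))) Q.1 = _ from Q.2.1]
      exact Ideal.comap_mono hPQ
    let Q0 : Z := ⟨⟨P, hP.1.1⟩, hPG, hP.1.2⟩
    refine ⟨Q0, le_antisymm ?_ (hht1 Q0)⟩
    rw [← PrimeSpectrum.height_eq_orderHeight]
    exact height_le_card_of_mem_minimalPrimes_chartIdeal p hI hht hA P hP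
  have hsum (Q : Z) : Order.height (j Q).1 + Order.coheight Q = d := by
    rw [hco]
    exact hQ (j Q)
  -- `Q0` has the smallest height in `Z`; as height and coheight add up to `d`, its coheight is the
  -- largest.
  have hdim : Order.krullDim Z = (Order.coheight Q0 : WithBot ℕ∞) := by
    refine le_antisymm ?_ (Order.coheight_le_krullDim Q0)
    rw [Order.krullDim_eq_iSup_coheight]
    refine iSup_le fun Q => WithBot.coe_le_coe.mpr ?_
    have h1 := hsum Q
    rw [← hsum Q0, hQ0] at h1
    have h2 := (add_le_add_left (hht1 Q) (Order.coheight Q)).trans h1.le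
    exact (ENat.add_le_add_iff_left (ENat.natCast_ne_top _)).mp h2
  rw [hdim]
  have := hsum Q0
  rw [hQ0, add_comm] at this
  exact_mod_cast this

end Chart
end SchubertInduction

/-! ### Krull dimension of topological spaces -/

namespace SchubertInduction

open PrimeSpectrum TopologicalSpace Topology

attribute [local instance] MvPolynomial.algebraMvPolynomial

section OpenCover

variable {T : Type*} [TopologicalSpace T] {J : Type*} {Y : J → Type*}
  [∀ j, TopologicalSpace (Y j)] (f : ∀ j, Y j → T)

/-- An irreducible closed set meets some member of the cover, and its coheight can be computed
there. -/
theorem topologicalKrullDim_eq_iSup_of_isOpenEmbedding (hf : ∀ j, IsOpenEmbedding (f j))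
    (hcov : ∀ x, ∃ j, x ∈ Set.range (f j)) :
    topologicalKrullDim T = ⨆ j, topologicalKrullDim (Y j) := by
  refine le_antisymm ?_ (iSup_le fun j => (hf j).isInducing.topologicalKrullDim_le)
  rw [topologicalKrullDim, Order.krullDim_eq_iSup_coheight]
  refine iSup_le fun Z => ?_
  obtain ⟨z, hz⟩ := Z.isIrreducible.nonempty
  obtain ⟨j, y, rfl⟩ := hcov z
  refine le_trans ?_ (le_iSup _ j)
  let Z' := (IrreducibleCloseds.orderIsoOfIsOpenEmbedding (f j) (hf j)).symm ⟨Z, y, hz⟩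
  have : Z = IrreducibleCloseds.map (f j) (hf j).continuous Z' :=
    congrArg Subtype.val ((IrreducibleCloseds.orderIsoOfIsOpenEmbedding (f j)
      (hf j)).apply_symm_apply ⟨Z, y, hz⟩).symm
  rw [this, (hf j).coheight_map]
  exact Order.coheight_le_krullDim Z'

theorem isEmpty_or_topologicalKrullDim_add_eq (hf : ∀ j, IsOpenEmbedding (f j))
    (hcov : ∀ x, ∃ j, x ∈ Set.range (f j)) (k : ℕ) (d : WithBot ℕ∞)
    (h : ∀ j, IsEmpty (Y j) ∨ topologicalKrullDim (Y j) + k = d) :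
    IsEmpty T ∨ topologicalKrullDim T + k = d := by
  by_cases hT : IsEmpty T
  · exact .inl hT
  right
  rw [not_isEmpty_iff] at hT
  obtain ⟨x⟩ := hT
  obtain ⟨j, y, -⟩ := hcov x
  have hj := (h j).resolve_left fun h => h.false y
  suffices topologicalKrullDim T = topologicalKrullDim (Y j) by rw [this, hj]
  rw [topologicalKrullDim_eq_iSup_of_isOpenEmbedding f hf hcov]
  refine le_antisymm (iSup_le fun i => ?_) (le_iSup (fun j => topologicalKrullDim (Y j)) j)
  rcases h i with hi | hi
  · rw [topologicalKrullDim, Order.krullDim_eq_bot_iff.mpr]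
    · exact bot_le
    · exact ⟨fun Z => Z.isIrreducible.nonempty.elim fun z _ => hi.false z⟩
  -- The finite number `k` cancels in `WithBot ℕ∞`, so all non-empty members have the same
  -- dimension.
  · rw [← hj] at hi
    refine le_of_eq ?_
    revert hi
    generalize topologicalKrullDim (Y i) = a
    generalize topologicalKrullDim (Y j) = b
    intro hi
    induction a with
    | bot => induction b with
      | bot => rfl
      | coe b => cases hi
    | coe a => induction b with
      | bot => cases hi
      | coe b =>
        have : a + k = b + k := by exact_mod_cast hi
        rw [(ENat.add_left_injective_of_ne_top (ENat.natCast_ne_top k)) this]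

end OpenCover

section Height

variable {T C : Type*} [TopologicalSpace T] [CommRing C]

/-- The closure of a point as an irreducible closed set. -/
def pointClosure (x : T) : IrreducibleCloseds T :=
  ⟨closure {x}, isIrreducible_singleton.closure, isClosed_closure⟩

theorem coheight_pointClosure_eq_height {f : PrimeSpectrum C → T} (hf : IsOpenEmbedding f)
    (Q : PrimeSpectrum C) : Order.coheight (pointClosure (f Q)) = Q.asIdeal.height := by
  have h1 : pointClosure (f Q) = IrreducibleCloseds.map f hf.continuous (pointClosure Q) := by
    ext1
    simp [pointClosure, closure_image_closure hf.continuous]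
  rw [h1, hf.coheight_map, PrimeSpectrum.height_eq_orderHeight,
    ← Order.height_orderIso (PrimeSpectrum.pointsEquivIrreducibleCloseds C) Q,
    ← Order.height_toDual]
  rfl

end Height

theorem height_eq_ringKrullDim_of_isMaximal (K C : Type u) [Field K] [CommRing C] [IsDomain C]
    [Algebra K C] [Algebra.FiniteType K C] (m : Ideal C) [hm : m.IsMaximal] :
    (m.height : WithBot ℕ∞) = ringKrullDim C := by
  obtain ⟨d, hd, h⟩ := exists_ringKrullDim_eq_and_height_add_coheight_eq K C
  have h1 := h ⟨m, hm.isPrime⟩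
  have h2 : Order.coheight (⟨m, hm.isPrime⟩ : PrimeSpectrum C) = 0 := by
    rw [Order.coheight_eq_zero]
    exact (PrimeSpectrum.isMax_iff).mpr hm
  rw [h2, add_zero, ← PrimeSpectrum.height_eq_orderHeight] at h1
  rw [hd]
  exact_mod_cast congrArg ((↑) : ℕ∞ → WithBot ℕ∞) h1

/-- Two charts of an irreducible Jacobson space share a closed point, and its codimension, which is
local, is the dimension of each of the two rings. -/
theorem ringKrullDim_eq_topologicalKrullDim (K : Type u) [Field K] {T : Type*}
    [TopologicalSpace T] [PreirreducibleSpace T] [JacobsonSpace T] {J : Type*} {C : J → Type u}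
    [∀ j, CommRing (C j)] [∀ j, IsDomain (C j)] [∀ j, Algebra K (C j)]
    [∀ j, Algebra.FiniteType K (C j)] (f : ∀ j, PrimeSpectrum (C j) → T)
    (hf : ∀ j, IsOpenEmbedding (f j)) (hcov : ∀ x, ∃ j, x ∈ Set.range (f j)) (j : J) :
    ringKrullDim (C j) = topologicalKrullDim T := by
  have key (i j : J) : ringKrullDim (C i) = ringKrullDim (C j) := by
    obtain ⟨x, ⟨hxi, hxj⟩, hx⟩ := nonempty_inter_closedPoints
      (nonempty_preirreducible_inter (hf i).isOpen_range (hf j).isOpen_range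
        (Set.range_nonempty _) (Set.range_nonempty _))
      ((hf i).isOpen_range.inter (hf j).isOpen_range).isLocallyClosed
    have aux (l : J) (hl : x ∈ Set.range (f l)) :
        ringKrullDim (C l) = (Order.coheight (pointClosure x) : WithBot ℕ∞) := by
      obtain ⟨m, rfl⟩ := hl
      have hm : m ∈ closedPoints (PrimeSpectrum (C l)) := by
        rw [← (hf l).preimage_closedPoints]
        exact hx
      have : m.asIdeal.IsMaximal := (isClosed_singleton_iff_isMaximal m).mp hm
      rw [coheight_pointClosure_eq_height (hf l), height_eq_ringKrullDim_of_isMaximal K]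
    rw [aux i hxi, aux j hxj]
  rw [topologicalKrullDim_eq_iSup_of_isOpenEmbedding f hf hcov]
  simp only [PrimeSpectrum.topologicalKrullDim_eq_ringKrullDim]
  have : Nonempty J := ⟨j⟩
  rw [iSup_congr fun i => key i j, ciSup_const]

/-- Irreducible closed subsets of `Z` correspond to their generic points with the order reversed,
and Krull dimension is invariant under this reversal. -/
theorem topologicalKrullDim_eq_krullDim {C : Type*} [CommRing C] (Z : Set (PrimeSpectrum C))
    [QuasiSober Z] : topologicalKrullDim Z = Order.krullDim Z := by
  have hle (x y : Z) : x ≤ y ↔ x ⤳ y :=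
    (PrimeSpectrum.le_iff_specializes x.1 y.1).trans (subtype_specializes_iff x y).symm
  let e : IrreducibleCloseds Z ≃o Zᵒᵈ :=
    { toEquiv := (irreducibleSetEquivPoints (α := Z)).toEquiv.trans OrderDual.toDual
      map_rel_iff' := by
        intro a b
        refine Iff.trans ?_ (irreducibleSetEquivPoints (α := Z)).map_rel_iff'
        exact hle _ _ }
  rw [topologicalKrullDim, Order.krullDim_eq_of_orderIso e, Order.krullDim_orderDual]

instance quasiSober_fiber_inter_zeroLocus {R S : Type*} [CommRing R] [CommRing S] [Algebra R S]
    (s : PrimeSpectrum R) (J : Set S) :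
    QuasiSober ↥(comap (algebraMap R S) ⁻¹' {s} ∩ zeroLocus J) := by
  have : QuasiSober ↥(comap (algebraMap R S) ⁻¹' {s}) :=
    (preimageHomeomorphFiber R S s).isClosedEmbedding.quasiSober
  refine IsClosedEmbedding.quasiSober (f := Set.inclusion Set.inter_subset_left)
    ⟨.inclusion _, ?_⟩
  convert (isClosed_zeroLocus J).preimage (continuous_subtype_val
    (p := (· ∈ comap (algebraMap R S) ⁻¹' {s})))
  ext x
  simp [Set.range_inclusion]

/-! ### The fibres of the intersection inside a chart of the ambient scheme -/

section Chart

variable {K A σ τ : Type u} [Field K] [CommRing A] [Algebra K A]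

/-- The chart of the intersection of `Spec A/p` with the family of closed subsets given by `L i`. -/
def chartFiber (p : Ideal A) (L : σ → Ideal (MvPolynomial (ULift.{u} (Fin 1)) A))
    (s : PrimeSpectrum (MvPolynomial σ K)) : Set (PrimeSpectrum (MvPolynomial σ A)) :=
  {Q | comap (algebraMap (MvPolynomial σ K) (MvPolynomial σ A)) Q = s ∧
    p ≤ Q.asIdeal.comap MvPolynomial.C ∧
    ∀ i, L i ≤ Q.asIdeal.comap (MvPolynomial.rename fun _ => i)}

theorem chartFiber_eq (p : Ideal A) (L : σ → Ideal (MvPolynomial (ULift.{u} (Fin 1)) A))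
    (s : PrimeSpectrum (MvPolynomial σ K)) :
    chartFiber p L s = comap (algebraMap (MvPolynomial σ K) (MvPolynomial σ A)) ⁻¹' {s} ∩
      zeroLocus ((p.map MvPolynomial.C ⊔ ⨆ i, (L i).map (MvPolynomial.rename fun _ => i) :
        Ideal (MvPolynomial σ A)) : Set (MvPolynomial σ A)) := by
  ext Q
  simp only [chartFiber, Set.mem_ofPred_eq, Set.mem_inter_iff, Set.mem_preimage,
    Set.mem_singleton_iff, mem_zeroLocus, SetLike.coe_subset_coe, sup_le_iff, iSup_le_iff,
    Ideal.map_le_iff_le_comap]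

theorem exists_topologicalKrullDim_chartFiber (p : Ideal A) [IsDomain A] [Algebra.FiniteType K A]
    [p.IsPrime] [Fintype σ] {L : σ → Ideal (MvPolynomial (ULift.{u} (Fin 1)) A)}
    (hI : ∀ i, ∀ q : Ideal A, q.IsPrime → ¬ L i ≤ q.map MvPolynomial.C)
    (hht : ∀ i, ∀ P ∈ (L i).minimalPrimes, P.height ≤ 1)
    (hA : ∀ (q : Ideal A) [q.IsPrime], IsIntegrallyClosed (Localization.AtPrime q)) :
    ∃ g : MvPolynomial σ K, g ≠ 0 ∧ ∀ s : PrimeSpectrum (MvPolynomial σ K), g ∉ s.asIdeal →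
      IsEmpty (chartFiber p L s) ∨
        topologicalKrullDim (chartFiber p L s) + (Fintype.card σ : ℕ) = ringKrullDim (A ⧸ p) := by
  let e : MvPolynomial (ULift.{u} (Fin 1)) A ≃+* Polynomial A :=
    (MvPolynomial.uniqueAlgEquiv A (ULift.{u} (Fin 1))).toRingEquiv
  have he (i : σ) : (MvPolynomial.map (Ideal.Quotient.mk p)).comp
      (MvPolynomial.rename (R := A) fun _ => i).toRingHom = (toVariable p i).comp e.toRingHom := by
    apply MvPolynomial.ringHom_ext
    · intro a
      simp [toVariable, e]
    · intro j
      simp [toVariable, e]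
  let I (i : σ) : Ideal (Polynomial A) := (L i).comap e.symm
  have hIe (i : σ) : I i = (L i).map e.toRingHom := Ideal.comap_symm e
  have hI' (i : σ) (q : Ideal A) (hq : q.IsPrime) : ¬ I i ≤ q.map Polynomial.C := by
    intro hle
    rw [hIe, Ideal.map_le_iff_le_comap] at hle
    refine hI i q hq (hle.trans (le_of_eq ?_))
    have hC : (Polynomial.C : A →+* Polynomial A) = (e : _ →+* Polynomial A).comp
        (MvPolynomial.C (σ := ULift.{u} (Fin 1))) := by
      ext a
      simp [e]
    rw [hC, ← Ideal.map_map]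
    exact Ideal.comap_map_of_bijective e e.bijective
  have hht' (i : σ) (P : Ideal (Polynomial A)) (hP : P ∈ (I i).minimalPrimes) : P.height ≤ 1 := by
    have hP' : P ∈ ((L i).comap (e.symm : Polynomial A →+* _)).minimalPrimes := hP
    rw [Ideal.comap_minimalPrimes_eq_of_surjective e.symm.surjective] at hP'
    obtain ⟨P', hP', rfl⟩ := hP'
    exact (RingEquiv.height_comap e.symm P').trans_le (hht i P' hP')
  obtain ⟨g, hg, hfib⟩ := exists_krullDim_fiber_chart (K := K) p hI' hht' hA
  · refine ⟨g, hg, fun s hs => ?_⟩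
    have hmem (Q : PrimeSpectrum (MvPolynomial σ (A ⧸ p))) :
        chartIdeal p I ≤ Q.asIdeal ↔ ∀ i, L i ≤ (comap (MvPolynomial.map
          (Ideal.Quotient.mk p)) Q).asIdeal.comap (MvPolynomial.rename fun _ => i) := by
      rw [chartIdeal, iSup_le_iff]
      refine forall_congr' fun i => ?_
      rw [hIe, Ideal.map_map, ← he, Ideal.map_le_iff_le_comap]
      rfl
    have hcomp : (MvPolynomial.map (Ideal.Quotient.mk p)).comp
        (algebraMap (MvPolynomial σ K) (MvPolynomial σ A)) =
        algebraMap (MvPolynomial σ K) (MvPolynomial σ (A ⧸ p)) := by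
      rw [MvPolynomial.algebraMap_def, MvPolynomial.algebraMap_def]
      apply MvPolynomial.ringHom_ext
      · intro a
        simp
      · intro i
        simp
    let f : ↥(comap (algebraMap (MvPolynomial σ K) (MvPolynomial σ (A ⧸ p))) ⁻¹' {s} ∩
        zeroLocus (chartIdeal p I : Set (MvPolynomial σ (A ⧸ p)))) →
        chartFiber p L s := fun Q => ⟨comap (MvPolynomial.map (Ideal.Quotient.mk p)) Q.1, by
          refine Eq.trans ?_ Q.2.1
          rw [← comap_comp_apply, hcomp], fun a ha => by
          change MvPolynomial.map (Ideal.Quotient.mk p) (MvPolynomial.C a) ∈ Q.1.asIdeal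
          rw [MvPolynomial.map_C, Ideal.Quotient.eq_zero_iff_mem.mpr ha, map_zero]
          exact zero_mem _, (hmem Q.1).mp Q.2.2⟩
    have hle (a b) : f a ≤ f b ↔ a ≤ b := by
      refine ⟨fun h x hx => ?_, fun h => Ideal.comap_mono h⟩
      obtain ⟨x, rfl⟩ := MvPolynomial.map_surjective _ Ideal.Quotient.mk_surjective x
      exact h hx
    have hsurj : Function.Surjective f := by
      rintro ⟨Q, hQ, hpQ, hJ⟩
      have hr : Q ∈ Set.range (comap (MvPolynomial.map (Ideal.Quotient.mk p))) := by
        rw [range_comap_of_surjective _ _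
          (MvPolynomial.map_surjective _ Ideal.Quotient.mk_surjective), MvPolynomial.ker_map,
          Ideal.mk_ker]
        exact Ideal.map_le_iff_le_comap.mpr hpQ
      obtain ⟨Q', rfl⟩ := hr
      refine ⟨⟨Q', ?_, (hmem Q').mpr hJ⟩, rfl⟩
      rw [Set.mem_preimage, ← hQ, ← comap_comp_apply, hcomp]
      rfl
    rw [show topologicalKrullDim (chartFiber p L s) = Order.krullDim (chartFiber p L s) by
      rw [chartFiber_eq]; exact topologicalKrullDim_eq_krullDim _]
    let F := RelIso.ofSurjective (OrderEmbedding.ofMapLEIff f hle) hsurj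
    rw [← Order.krullDim_eq_of_orderIso F, ← F.toEquiv.isEmpty_congr]
    exact hfib s hs

theorem topologicalKrullDim_add_height_le [IsDomain A] [Algebra.FiniteType K A] [Finite σ]
    (P : PrimeSpectrum (MvPolynomial σ A))
    (hP : comap (algebraMap (MvPolynomial σ K) (MvPolynomial σ A)) P = ⟨⊥, Ideal.isPrime_bot⟩) :
    topologicalKrullDim ↥(comap (algebraMap (MvPolynomial σ K) (MvPolynomial σ A)) ⁻¹'
      {⟨⊥, Ideal.isPrime_bot⟩} ∩ zeroLocus (P.asIdeal : Set (MvPolynomial σ A))) +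
        P.asIdeal.height ≤ ringKrullDim A := by
  obtain ⟨d, hd, hQ⟩ := height_add_coheight_genericFiber K A σ
  have h1 : topologicalKrullDim ↥(comap (algebraMap (MvPolynomial σ K) (MvPolynomial σ A)) ⁻¹'
      {⟨⊥, Ideal.isPrime_bot⟩} ∩ zeroLocus (P.asIdeal : Set (MvPolynomial σ A))) ≤
      (Order.coheight (⟨P, hP⟩ : ↥(comap (algebraMap (MvPolynomial σ K) (MvPolynomial σ A)) ⁻¹'
        {⟨⊥, Ideal.isPrime_bot⟩})) : WithBot ℕ∞) := by
    rw [topologicalKrullDim_eq_krullDim, Order.coheight_eq_krullDim_Ici]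
    exact Order.krullDim_le_of_strictMono (fun Q => ⟨⟨Q.1, Q.2.1⟩, Q.2.2⟩) fun a b h => h
  refine (add_le_add_left h1 _).trans (le_of_eq ?_)
  rw [hd, add_comm, PrimeSpectrum.height_eq_orderHeight]
  exact_mod_cast congrArg ((↑) : ℕ∞ → WithBot ℕ∞) (hQ ⟨P, hP⟩)

end Chart

end SchubertInduction

/-! ### Charts of affine space -/

namespace SchubertInduction

section AffineChart

variable (n : Type u) {X : Scheme.{u}} {A : CommRingCat.{u}} (ι : Spec A ⟶ X)

/-- The chart of `𝔸ⁿ_X` over a chart `Spec A ⟶ X`. -/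
noncomputable def chart : Spec (.of (MvPolynomial n A)) ⟶ 𝔸(n; X) :=
  (AffineSpace.SpecIso n A).inv ≫ AffineSpace.map n ι

theorem chart_over :
    chart n ι ≫ (𝔸(n; X) ↘ X) = Spec.map (CommRingCat.ofHom MvPolynomial.C) ≫ ι := by
  rw [chart, Category.assoc, AffineSpace.map_over, AffineSpace.SpecIso_inv_over_assoc]

theorem chart_map {B : CommRingCat.{u}} {f : X ⟶ Spec B} {φ : B ⟶ A} (h : ι ≫ f = Spec.map φ) :
    chart n ι ≫ AffineSpace.map n f =
      Spec.map (CommRingCat.ofHom (MvPolynomial.map φ.hom)) ≫ (AffineSpace.SpecIso n B).inv := by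
  rw [chart, Category.assoc, ← AffineSpace.map_comp, h, AffineSpace.map_SpecMap]
  simp

theorem chart_reindex {m : Type u} (i : m → n) :
    chart n ι ≫ AffineSpace.reindex i X =
      Spec.map (CommRingCat.ofHom (MvPolynomial.rename (R := A) i).toRingHom) ≫ chart m ι := by
  rw [chart, chart, Category.assoc, AffineSpace.map_reindex, ← Category.assoc, ← Category.assoc]
  congr 1
  apply AffineSpace.hom_ext
  · rw [Category.assoc, Category.assoc, AffineSpace.reindex_over, AffineSpace.SpecIso_inv_over,
      AffineSpace.SpecIso_inv_over, ← Spec.map_comp]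
    congr 1
    ext
    simp
  · intro j
    simp only [Scheme.Hom.comp_appTop, CommRingCat.comp_apply,
      AffineSpace.reindex_appTop_coord, AffineSpace.SpecIso_inv_appTop_coord]
    rw [← CommRingCat.comp_apply, ← Scheme.ΓSpecIso_inv_naturality, CommRingCat.comp_apply]
    simp

instance [IsOpenImmersion ι] : IsOpenImmersion (AffineSpace.map n ι) :=
  MorphismProperty.of_isPullback (AffineSpace.isPullback_map ι).flip inferInstance

instance [IsOpenImmersion ι] : IsOpenImmersion (chart n ι) := by
  unfold chart
  infer_instance

theorem range_chart [IsOpenImmersion ι] :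
    Set.range (chart n ι) = (𝔸(n; X) ↘ X) ⁻¹' Set.range ι := by
  have h := AffineSpace.isPullback_map (n := n) ι
  have h1 : chart n ι = ((AffineSpace.SpecIso n A).inv ≫ h.isoPullback.hom) ≫
      Limits.pullback.fst (𝔸(n; X) ↘ X) ι := by
    rw [Category.assoc, h.isoPullback_hom_fst, chart]
  rw [← Scheme.Pullback.range_fst, h1]
  ext x
  constructor
  · rintro ⟨y, rfl⟩
    exact ⟨_, (Scheme.Hom.comp_apply _ _ _).symm⟩
  · rintro ⟨y, rfl⟩
    obtain ⟨z, rfl⟩ := ((AffineSpace.SpecIso n A).inv ≫ h.isoPullback.hom).surjective y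
    exact ⟨z, Scheme.Hom.comp_apply _ _ _⟩

theorem chart_apply_over (Q : Spec (.of (MvPolynomial n A))) :
    (𝔸(n; X) ↘ X) (chart n ι Q) = ι (Spec.map (CommRingCat.ofHom MvPolynomial.C) Q) := by
  rw [← Scheme.Hom.comp_apply, chart_over, Scheme.Hom.comp_apply]

theorem chart_apply_map {B : CommRingCat.{u}} {f : X ⟶ Spec B} {φ : B ⟶ A}
    (h : ι ≫ f = Spec.map φ) (Q : Spec (.of (MvPolynomial n A))) :
    AffineSpace.map n f (chart n ι Q) = (AffineSpace.SpecIso n B).inv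
      (Spec.map (CommRingCat.ofHom (MvPolynomial.map φ.hom)) Q) := by
  rw [← Scheme.Hom.comp_apply, chart_map n ι h, Scheme.Hom.comp_apply]

theorem chart_apply_reindex {m : Type u} (i : m → n) (Q : Spec (.of (MvPolynomial n A))) :
    AffineSpace.reindex i X (chart n ι Q) = chart m ι
      (Spec.map (CommRingCat.ofHom (MvPolynomial.rename (R := A) i).toRingHom) Q) := by
  rw [← Scheme.Hom.comp_apply, chart_reindex, Scheme.Hom.comp_apply]

end AffineChart

section FiberOfClosed

variable {E B : Scheme.{u}} (Y : E.IdealSheafData) (g : E ⟶ B) (s : B)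

theorem image_subschemeι_preimage :
    Y.subschemeι '' ((Y.subschemeι ≫ g) ⁻¹' {s}) = g ⁻¹' {s} ∩ Y.support := by
  rw [← Scheme.IdealSheafData.range_subschemeι, ← Set.image_preimage_eq_inter_range]
  congr 1

/-- The fibre of a closed subscheme is a subspace of the fibre. -/
noncomputable def fiberSubschemeHomeo :
    (Y.subschemeι ≫ g).fiber s ≃ₜ ↥(g ⁻¹' {s} ∩ (Y.support : Set E)) :=
  (((Y.subschemeι ≫ g).fiberHomeo s).trans
    (Y.subschemeι.isClosedEmbedding.isEmbedding.homeomorphImage _)).trans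
      (Homeomorph.setCongr (image_subschemeι_preimage Y g s))

end FiberOfClosed

section Cover

variable {K : Type u} [Field K] {X : Scheme.{u}} [X.Over (Spec (.of K))]

theorem finiteType_of_comp_eq [LocallyOfFiniteType (X ↘ Spec (.of K))] {A : CommRingCat.{u}}
    [Algebra K A] (ι : Spec A ⟶ X) [IsOpenImmersion ι]
    (h : ι ≫ (X ↘ Spec (.of K)) = Spec.map (CommRingCat.ofHom (algebraMap K A))) :
    Algebra.FiniteType K A := by
  have h1 : LocallyOfFiniteType (ι ≫ (X ↘ Spec (.of K))) := inferInstance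
  rw [h, HasRingHomProperty.Spec_iff (P := @LocallyOfFiniteType)] at h1
  exact RingHom.finiteType_algebraMap.mp h1

theorem isDomain_of_isOpenImmersion [IsIntegral X] {A : CommRingCat.{u}} [Nontrivial A]
    (ι : Spec A ⟶ X) [IsOpenImmersion ι] : IsDomain A := by
  have : Nonempty (Spec A) := inferInstanceAs (Nonempty (PrimeSpectrum A))
  have : IsIntegral (Spec A) := isIntegral_of_isOpenImmersion ι
  exact (affine_isIntegral_iff A).mp this

theorem isIntegrallyClosed_localization (hX : IsNormalScheme X) {A : CommRingCat.{u}}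
    (ι : Spec A ⟶ X) [IsOpenImmersion ι] (q : Ideal A) [hq : q.IsPrime] :
    IsIntegrallyClosed (Localization.AtPrime q) := by
  let x : Spec A := ⟨q, hq⟩
  have h1 := (hX (ι x)).2
  have h2 : IsIntegrallyClosed ((Spec A).presheaf.stalk x) :=
    IsIntegrallyClosed.of_equiv (asIso (ι.stalkMap x)).commRingCatIsoToRingEquiv
  exact IsIntegrallyClosed.of_equiv (Spec.stalkIso A x).commRingCatIsoToRingEquiv

end Cover

end SchubertInduction

/-! ### Families over the affine line -/

namespace SchubertInduction

open PrimeSpectrum TopologicalSpace Topology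

attribute [local instance] MvPolynomial.algebraMvPolynomial

section Topology

variable {T A : Type*} [TopologicalSpace T] [CommRing A]

theorem vanishingIdeal_preimage_le_iff {f : PrimeSpectrum A → T} (hf : Continuous f) {S : Set T}
    (hS : IsClosed S) (q : PrimeSpectrum A) : vanishingIdeal (f ⁻¹' S) ≤ q.asIdeal ↔ f q ∈ S := by
  rw [← SetLike.coe_subset_coe, ← mem_zeroLocus, zeroLocus_vanishingIdeal_eq_closure,
    (hS.preimage hf).closure_eq, Set.mem_preimage]

/-- The chart of a closed subset `S` induced by a chart of the ambient space. -/
def quotientChart (f : PrimeSpectrum A → T) (S : Set T) (hf : IsOpenEmbedding f) (hS : IsClosed S)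
    (Q : PrimeSpectrum (A ⧸ vanishingIdeal (f ⁻¹' S))) : S :=
  ⟨f (comap (Ideal.Quotient.mk _) Q), by
    rw [← vanishingIdeal_preimage_le_iff hf.continuous hS]
    intro a ha
    change Ideal.Quotient.mk _ a ∈ Q.asIdeal
    rw [Ideal.Quotient.eq_zero_iff_mem.mpr ha]
    exact zero_mem _⟩

theorem range_quotientChart (f : PrimeSpectrum A → T) (S : Set T) (hf : IsOpenEmbedding f)
    (hS : IsClosed S) : Set.range (quotientChart f S hf hS) = Subtype.val ⁻¹' Set.range f := by
  ext x
  constructor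
  · rintro ⟨Q, rfl⟩
    exact ⟨_, rfl⟩
  · rintro ⟨P, hP⟩
    have h : P ∈ Set.range (comap (Ideal.Quotient.mk (vanishingIdeal (f ⁻¹' S)))) := by
      rw [range_comap_of_surjective _ _ Ideal.Quotient.mk_surjective, Ideal.mk_ker,
        zeroLocus_vanishingIdeal_eq_closure, (hS.preimage hf.continuous).closure_eq,
        Set.mem_preimage, hP]
      exact x.2
    obtain ⟨Q, rfl⟩ := h
    exact ⟨Q, Subtype.ext hP⟩

theorem isOpenEmbedding_quotientChart (f : PrimeSpectrum A → T) (S : Set T)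
    (hf : IsOpenEmbedding f) (hS : IsClosed S) : IsOpenEmbedding (quotientChart f S hf hS) := by
  refine ⟨?_, ?_⟩
  · exact (hf.isEmbedding.comp (isClosedEmbedding_comap_of_surjective _ _
      Ideal.Quotient.mk_surjective).isEmbedding).codRestrict S _
  · rw [range_quotientChart]
    exact hf.isOpen_range.preimage continuous_subtype_val

/-- The generic point of a larger irreducible closed set would be a proper generalization of `x`. -/
theorem closure_singleton_mem_irreducibleComponents [QuasiSober T] {x : T}
    (hx : ∀ y, y ⤳ x → y = x) : closure {x} ∈ irreducibleComponents T := by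
  refine ⟨isIrreducible_singleton.closure, fun S hS hle => ?_⟩
  obtain ⟨t, ht⟩ := QuasiSober.sober hS.closure isClosed_closure
  have : t = x := by
    refine hx t (specializes_iff_mem_closure.mpr ?_)
    rw [ht.def]
    exact subset_closure (hle (subset_closure rfl))
  rw [← this, ht.def]
  exact subset_closure

end Topology

theorem iSup_add_le_natCast {J : Type*} (a : J → WithBot ℕ∞) (k d : ℕ)
    (h : ∀ j, a j + k ≤ d) : (⨆ j, a j) + k ≤ d := by
  by_cases hkd : k ≤ d
  · have h1 (j : J) : a j ≤ ((d - k : ℕ) : WithBot ℕ∞) := by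
      have := h j
      generalize a j = b at this ⊢
      induction b with
      | bot => exact bot_le
      | coe b =>
        have h2 : b + k ≤ d := by exact_mod_cast this
        have h3 : b ≤ (d - k : ℕ) := by
          rw [ENat.natCast_sub]
          exact ENat.le_sub_of_add_le_right (ENat.natCast_ne_top k) h2
        exact WithBot.coe_le_coe.mpr h3
    calc (⨆ j, a j) + k ≤ ((d - k : ℕ) : WithBot ℕ∞) + k := add_le_add_left (iSup_le h1) _
      _ = d := by exact_mod_cast congrArg ((↑) : ℕ → WithBot ℕ∞) (Nat.sub_add_cancel hkd)
  -- When `k > d` the bound leaves only the value `⊥`, that of an empty space.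
  · have h1 (j : J) : a j = ⊥ := by
      have := h j
      generalize a j = b at this ⊢
      induction b with
      | bot => rfl
      | coe b =>
        have h2 : b + k ≤ d := by exact_mod_cast this
        have h3 : (k : ℕ∞) ≤ d := le_add_self.trans h2
        exact absurd (by exact_mod_cast h3) hkd
    simp [h1]

section Cover

variable {K : Type u} [Field K] {X : Scheme.{u}} [X.Over (Spec (.of K))]
  [LocallyOfFiniteType (X ↘ Spec (.of K))]
  {J : Type*} {A : J → CommRingCat.{u}} [∀ j, Algebra K (A j)]
  (ι : ∀ j, Spec (A j) ⟶ X) [∀ j, IsOpenImmersion (ι j)]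

theorem jacobsonSpace_of_over_field (K : Type u) [Field K] (X : Scheme.{u}) [X.Over (Spec (.of K))]
    [LocallyOfFiniteType (X ↘ Spec (.of K))] : JacobsonSpace X :=
  LocallyOfFiniteType.jacobsonSpace (X ↘ Spec (.of K))

theorem ringKrullDim_quotient_eq_topologicalKrullDim
    (hι : ∀ j, ι j ≫ (X ↘ Spec (.of K)) = Spec.map (CommRingCat.ofHom (algebraMap K (A j))))
    (hcov : ∀ x, ∃ j, x ∈ Set.range (ι j)) {S : Set X} (hS : IsClosed S) (hS' : IsIrreducible S)
    (j : J) (hj : (ι j ⁻¹' S).Nonempty) :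
    ringKrullDim (A j ⧸ vanishingIdeal (R := A j) (ι j ⁻¹' S)) = topologicalKrullDim S := by
  have (j : J) : Algebra.FiniteType K (A j) := finiteType_of_comp_eq (ι j) (hι j)
  have hop (j : J) : IsOpenEmbedding (X := PrimeSpectrum (A j)) (ι j) := (ι j).isOpenEmbedding
  have := jacobsonSpace_of_over_field K X
  have : JacobsonSpace S := .of_isClosedEmbedding hS.isClosedEmbedding_subtypeVal
  have : PreirreducibleSpace S := (Subtype.preirreducibleSpace hS'.isPreirreducible)
  have (j : {j // (ι j ⁻¹' S).Nonempty}) :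
      (vanishingIdeal (R := A j.1) (ι j.1 ⁻¹' S)).IsPrime := by
    rw [← PrimeSpectrum.isIrreducible_iff_vanishingIdeal_isPrime]
    exact ⟨j.2, hS'.isPreirreducible.preimage (hop j.1)⟩
  exact ringKrullDim_eq_topologicalKrullDim K (J := {j // (ι j ⁻¹' S).Nonempty})
    (C := fun j => A j.1 ⧸ vanishingIdeal (R := A j.1) (ι j.1 ⁻¹' S))
    (fun j => quotientChart (ι j.1) S (hop j.1) hS)
    (fun j => isOpenEmbedding_quotientChart _ _ _ _) (fun x => by
      obtain ⟨j, q, hq⟩ := hcov x.1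
      refine ⟨⟨j, q, by rw [Set.mem_preimage, hq]; exact x.2⟩, ?_⟩
      exact (range_quotientChart _ _ _ _).ge ⟨q, hq⟩) ⟨j, hj⟩

theorem ringKrullDim_chart_eq_topologicalKrullDim [IsIntegral X] [∀ j, Nontrivial (A j)]
    (hι : ∀ j, ι j ≫ (X ↘ Spec (.of K)) = Spec.map (CommRingCat.ofHom (algebraMap K (A j))))
    (hcov : ∀ x, ∃ j, x ∈ Set.range (ι j)) (j : J) :
    ringKrullDim (A j) = topologicalKrullDim X := by
  have (j : J) : Algebra.FiniteType K (A j) := finiteType_of_comp_eq (ι j) (hι j)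
  have (j : J) : IsDomain (A j) := isDomain_of_isOpenImmersion (ι j)
  have := jacobsonSpace_of_over_field K X
  exact ringKrullDim_eq_topologicalKrullDim K (C := fun j => A j) (fun j => ι j)
    (fun j => (ι j).isOpenEmbedding) hcov j

end Cover

/-! ### Equations of a family over the line, and the height of their minimal primes -/

section Family

variable {K : Type u} [Field K] {X : Scheme.{u}} [X.Over (Spec (.of K))]

/-- The ideal of the chart `𝔸¹_A` of `𝔸¹_X` given by the support of `Y`. -/
noncomputable def lineIdeal {A : CommRingCat.{u}} (ι : Spec A ⟶ X)
    (Y : (ProdAff 1 X).IdealSheafData) : Ideal (MvPolynomial (ULift.{u} (Fin 1)) A) :=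
  vanishingIdeal (R := MvPolynomial (ULift.{u} (Fin 1)) A)
    (chart (ULift.{u} (Fin 1)) ι ⁻¹' (Y.support : Set (ProdAff 1 X)))

theorem lineIdeal_le_iff {A : CommRingCat.{u}} (ι : Spec A ⟶ X)
    (Y : (ProdAff 1 X).IdealSheafData)
    (Q : PrimeSpectrum (MvPolynomial (ULift.{u} (Fin 1)) A)) :
    lineIdeal ι Y ≤ Q.asIdeal ↔ chart (ULift.{u} (Fin 1)) ι Q ∈ Y.support :=
  vanishingIdeal_preimage_le_iff (A := MvPolynomial (ULift.{u} (Fin 1)) A)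
    (f := chart (ULift.{u} (Fin 1)) ι) (chart (ULift.{u} (Fin 1)) ι).continuous Y.support.isClosed Q

/-- The points of `𝔸¹` over `x = ι q` are primes containing `q[X]`; an inclusion would put all of
`{x} × 𝔸¹` into the family. -/
theorem not_lineIdeal_le_map_C {A : CommRingCat.{u}} (ι : Spec A ⟶ X) [IsOpenImmersion ι]
    {Y : (ProdAff 1 X).IdealSheafData} (hY : fibreIntersection Y = ∅) (q : Ideal A)
    (hq : q.IsPrime) : ¬ lineIdeal ι Y ≤ q.map MvPolynomial.C := by
  intro hle
  have hx : ι (⟨q, hq⟩ : PrimeSpectrum A) ∉ fibreIntersection Y := by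
    rw [hY]
    exact Set.notMem_empty _
  obtain ⟨z, hz, hzY⟩ : ∃ z, toBase 1 X z = ι (⟨q, hq⟩ : PrimeSpectrum A) ∧ z ∉ Y.support := by
    by_contra! h
    exact hx h
  have hzr : z ∈ Set.range (chart (ULift.{u} (Fin 1)) ι) := by
    rw [range_chart]
    exact ⟨_, hz.symm⟩
  obtain ⟨Q, rfl⟩ := hzr
  refine hzY ((lineIdeal_le_iff ι Y Q).mp (hle.trans (Ideal.map_le_iff_le_comap.mpr ?_)))
  have h1 := ι.isOpenEmbedding.injective ((chart_apply_over _ ι Q).symm.trans hz)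
  have h2 := congrArg PrimeSpectrum.asIdeal h1
  exact h2.ge

/-- The generic point of affine space. -/
noncomputable def affineGenericPoint (K : Type u) [Field K] (n : Type u) :
    𝔸(n; Spec (.of K)) :=
  (AffineSpace.SpecIso n (.of K)).inv (⟨⊥, Ideal.isPrime_bot⟩ : PrimeSpectrum (MvPolynomial n K))

theorem affineGenericPoint_specializes (n : Type u) (s : 𝔸(n; Spec (.of K))) :
    affineGenericPoint K n ⤳ s := by
  obtain ⟨s, rfl⟩ := (AffineSpace.SpecIso n (.of K)).inv.surjective s
  refine Specializes.map ?_ (AffineSpace.SpecIso n (.of K)).inv.continuous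
  exact (PrimeSpectrum.le_iff_specializes (R := MvPolynomial n K) ⟨⊥, Ideal.isPrime_bot⟩ s).mp
    bot_le

variable [IsIntegral X] [LocallyOfFiniteType (X ↘ Spec (.of K))]

/-- For `T` lying in the closure of `y` inside the generic fibre, this is dimension plus
codimension, seen in one chart. The space `T` is abstract so that a component of a scheme-theoretic
fibre can be inserted. -/
theorem topologicalKrullDim_preimage_chart_add_height_le (n : Type u) [Finite n]
    {A : CommRingCat.{u}} [Algebra K A] [Nontrivial A] (ι : Spec A ⟶ X) [IsOpenImmersion ι]
    (hι : ι ≫ (X ↘ Spec (.of K)) = Spec.map (CommRingCat.ofHom (algebraMap K A)))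
    {T : Type*} [TopologicalSpace T] {h : T → 𝔸(n; X)} (hh : IsInducing h)
    {y : 𝔸(n; X)} (hy : ∀ t, y ⤳ h t)
    (hη : AffineSpace.map n (X ↘ Spec (.of K)) y = affineGenericPoint K n)
    (hη' : ∀ t, AffineSpace.map n (X ↘ Spec (.of K)) (h t) = affineGenericPoint K n) :
    topologicalKrullDim ↥(h ⁻¹' Set.range (chart n ι)) + Order.coheight (pointClosure y) ≤
      ringKrullDim A := by
  have : Algebra.FiniteType K A := finiteType_of_comp_eq ι hι
  have : IsDomain A := isDomain_of_isOpenImmersion ι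
  have hop : IsOpenEmbedding (X := PrimeSpectrum (MvPolynomial n A)) (chart n ι) :=
    (chart n ι).isOpenEmbedding
  have hgen (Q : PrimeSpectrum (MvPolynomial n A))
      (hQ : AffineSpace.map n (X ↘ Spec (.of K)) (chart n ι Q) = affineGenericPoint K n) :
      comap (algebraMap (MvPolynomial n K) (MvPolynomial n A)) Q = ⟨⊥, Ideal.isPrime_bot⟩ := by
    rw [MvPolynomial.algebraMap_def]
    exact (AffineSpace.SpecIso n (.of K)).inv.isOpenEmbedding.injective
      ((chart_apply_map n ι hι Q).symm.trans hQ)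
  by_cases hemp : IsEmpty ↥(h ⁻¹' Set.range (chart n ι))
  · rw [topologicalKrullDim, Order.krullDim_eq_bot_iff.mpr]
    · exact bot_le
    · exact ⟨fun Z => Z.isIrreducible.nonempty.elim fun z _ => hemp.false z⟩
  rw [not_isEmpty_iff] at hemp
  obtain ⟨P, rfl⟩ : y ∈ Set.range (chart n ι) := by
    obtain ⟨t, ht⟩ := hemp
    exact (hy t).mem_open hop.isOpen_range ht
  choose r hr using fun t : ↥(h ⁻¹' Set.range (chart n ι)) => t.2
  refine le_trans ?_ (topologicalKrullDim_add_height_le (K := K) (σ := n) (A := A) P (hgen P hη))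
  rw [show Order.coheight (pointClosure (chart n ι P)) = _ from
    coheight_pointClosure_eq_height hop P]
  have hle (t) : P.asIdeal ≤ (r t).asIdeal := by
    have h1 : chart n ι P ⤳ chart n ι (r t) := by
      rw [hr]
      exact hy t
    exact (PrimeSpectrum.le_iff_specializes (R := MvPolynomial n A) P (r t)).mpr
      (hop.isInducing.specializes_iff.mp h1)
  refine add_le_add_left (IsInducing.topologicalKrullDim_le
    (f := fun t => ⟨r t, hgen _ (by rw [hr]; exact hη' _), hle t⟩) ?_) _
  refine IsInducing.of_comp_iff IsInducing.subtypeVal |>.mp ?_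
  have h2 : IsInducing (chart n ι ∘ r) := by
    rw [show chart n ι ∘ r = h ∘ Subtype.val from funext hr]
    exact hh.comp .subtypeVal
  exact (IsInducing.of_comp_iff (Y := PrimeSpectrum (MvPolynomial n A))
    hop.isInducing).mp h2

/-- The prime `P` is the generic point of a component of the family. Generalizations lift along flat
morphisms, so it lies over the generic point of `𝔸¹` and generates a component of that fibre, of
dimension `dim X - 1`. The dimension formula leaves at most one for the height. -/
theorem height_le_one_of_mem_minimalPrimes_lineIdeal {J : Type*} {A : J → CommRingCat.{u}}
    [∀ j, Algebra K (A j)] [∀ j, Nontrivial (A j)] (ι : ∀ j, Spec (A j) ⟶ X)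
    [∀ j, IsOpenImmersion (ι j)]
    (hι : ∀ j, ι j ≫ (X ↘ Spec (.of K)) = Spec.map (CommRingCat.ofHom (algebraMap K (A j))))
    (hcov : ∀ x, ∃ j, x ∈ Set.range (ι j)) {Y : (ProdAff 1 X).IdealSheafData}
    (hY : IsFamilyOfCodim K Y 1) (j : J) (P : Ideal (MvPolynomial (ULift.{u} (Fin 1)) (A j)))
    (hP : P ∈ (lineIdeal (ι j) Y).minimalPrimes) : P.height ≤ 1 := by
  have hPprime := hP.1.1
  have hop : IsOpenEmbedding (X := PrimeSpectrum (MvPolynomial (ULift.{u} (Fin 1)) (A j)))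
      (chart (ULift.{u} (Fin 1)) (ι j)) := (chart _ (ι j)).isOpenEmbedding
  let Q₀ : PrimeSpectrum (MvPolynomial (ULift.{u} (Fin 1)) (A j)) := ⟨P, hPprime⟩
  obtain ⟨y', hy'⟩ : chart _ (ι j) Q₀ ∈ Set.range Y.subschemeι := by
    rw [Scheme.IdealSheafData.range_subschemeι]
    exact (lineIdeal_le_iff (ι j) Y Q₀).mp hP.1.2
  have hmin (z : Y.subscheme) (hz : z ⤳ y') : z = y' := by
    have h1 := hz.map Y.subschemeι.continuous
    rw [hy'] at h1
    obtain ⟨Q₁, hQ₁⟩ := h1.mem_open hop.isOpen_range ⟨Q₀, rfl⟩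
    have h2 : Q₁ ≤ Q₀ := by
      rw [PrimeSpectrum.le_iff_specializes, ← hop.isInducing.specializes_iff, hQ₁]
      exact h1
    have h3 : lineIdeal (ι j) Y ≤ Q₁.asIdeal := by
      rw [lineIdeal_le_iff, hQ₁, ← SetLike.mem_coe, ← Scheme.IdealSheafData.range_subschemeι]
      exact ⟨z, rfl⟩
    have h4 : Q₁ = Q₀ := le_antisymm h2 (hP.2 ⟨Q₁.2, h3⟩ h2)
    apply Y.subschemeι.isEmbedding.injective
    rw [hy', ← hQ₁, h4]
  set f := Y.subschemeι ≫ toAff K 1 X with hf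
  have hflat : Flat f := hY.flat
  set η := affineGenericPoint K (ULift.{u} (Fin 1))
  have hfy : f y' = η := by
    obtain ⟨z, hz, hzη⟩ := Flat.generalizingMap f (affineGenericPoint_specializes _ (f y'))
    rw [← hmin z hz]
    exact hzη
  let e := f.fiberHomeo η
  let w : f.fiber η := e.symm ⟨y', hfy⟩
  have hιw : f.fiberι η w = y' := f.fiberι_fiberHomeo_symm η ⟨y', hfy⟩
  have hcomp := hY.codim η (closure {w}) (closure_singleton_mem_irreducibleComponents fun z hz => by
    apply (f.fiberι η).isEmbedding.injective
    rw [hιw]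
    refine hmin _ ?_
    rw [← hιw]
    exact hz.map (f.fiberι η).continuous)
  have (j : J) : Algebra.FiniteType K (A j) := finiteType_of_comp_eq (ι j) (hι j)
  have (j : J) : IsDomain (A j) := isDomain_of_isOpenImmersion (ι j)
  obtain ⟨d, hd, -⟩ := exists_ringKrullDim_eq_and_height_add_coheight_eq K (A j)
  have hdX := (ringKrullDim_chart_eq_topologicalKrullDim ι hι hcov j).symm.trans hd
  let h : closure {w} → ProdAff 1 X := fun t => Y.subschemeι (f.fiberι η t.1)
  have hh : IsInducing h := Y.subschemeι.isEmbedding.isInducing.comp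
    ((f.fiberι η).isEmbedding.isInducing.comp .subtypeVal)
  have hη' (z : f.fiber η) : toAff K 1 X (Y.subschemeι (f.fiberι η z)) = η := by
    rw [← Scheme.Hom.comp_apply]
    exact (e z).2
  by_contra! hlt
  have hle (i : J) := topologicalKrullDim_preimage_chart_add_height_le (ULift.{u} (Fin 1)) (ι i)
    (hι i) hh (y := chart _ (ι j) Q₀) (fun t => by
      rw [← hy', ← hιw]
      exact ((specializes_iff_mem_closure.mpr t.2).map (f.fiberι η).continuous).map
        Y.subschemeι.continuous) (by rw [← hy', ← hιw]; exact hη' w) (fun t => hη' t.1)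
  have hcovh (t : closure {w}) : ∃ i, t ∈ Set.range
      (Subtype.val : ↥(h ⁻¹' Set.range (chart (ULift.{u} (Fin 1)) (ι i))) → closure {w}) := by
    obtain ⟨i, hi⟩ := hcov (toBase 1 X (h t))
    refine ⟨i, ⟨t, ?_⟩, rfl⟩
    rw [Set.mem_preimage, range_chart]
    exact hi
  -- If the height were at least 2, every chart would bound the dimension of the component by `d -
  -- 2`, whereas it is `d - 1`.
  have hsum := iSup_add_le_natCast (fun i => topologicalKrullDim
    ↥(h ⁻¹' Set.range (chart (ULift.{u} (Fin 1)) (ι i)))) 2 d (fun i => by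
      refine le_trans ?_ ((hle i).trans_eq ?_)
      · rw [coheight_pointClosure_eq_height hop]
        refine add_le_add_right ?_ _
        have : (2 : ℕ∞) ≤ P.height := by
          rw [← one_add_one_eq_two]
          exact Order.add_one_le_of_lt hlt
        exact WithBot.coe_le_coe.mpr this
      · rw [ringKrullDim_chart_eq_topologicalKrullDim ι hι hcov i, hdX])
  rw [← topologicalKrullDim_eq_iSup_of_isOpenEmbedding _ (fun i =>
    ((chart _ (ι i)).isOpenEmbedding.isOpen_range.preimage
      hh.continuous).isOpenEmbedding_subtypeVal) hcovh] at hsum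
  rw [hdX] at hcomp
  have : (d : WithBot ℕ∞) + 1 ≤ d := by
    refine le_trans (le_of_eq ?_) hsum
    rw [← hcomp, add_assoc]
    norm_num
  have h5 : d + 1 ≤ d := by exact_mod_cast this
  omega

end Family

end SchubertInduction

/-! ### General position -/

namespace SchubertInduction

open PrimeSpectrum TopologicalSpace Topology

attribute [local instance] MvPolynomial.algebraMvPolynomial

variable {K : Type u} [Field K] {X : Scheme.{u}} [X.Over (Spec (.of K))]

theorem exists_finite_affine_cover [CompactSpace X] :
    ∃ (J : Type u) (_ : Fintype J) (A : J → CommRingCat.{u}) (_ : ∀ j, Nontrivial (A j))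
      (_ : ∀ j, Algebra K (A j)) (ι : ∀ j, Spec (A j) ⟶ X) (_ : ∀ j, IsOpenImmersion (ι j)),
      (∀ j, ι j ≫ (X ↘ Spec (.of K)) = Spec.map (CommRingCat.ofHom (algebraMap K (A j)))) ∧
      ∀ x, ∃ j, x ∈ Set.range (ι j) := by
  let 𝒰 := X.affineOpenCover
  obtain ⟨t, ht⟩ := isCompact_univ.elim_finite_subcover
    (fun x : X => Set.range (𝒰.f (𝒰.idx x))) (fun x => (𝒰.f _).isOpenEmbedding.isOpen_range)
    (fun x _ => Set.mem_iUnion.mpr ⟨x, 𝒰.covers x⟩)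
  let φ (j : t) : CommRingCat.of K ⟶ 𝒰.X (𝒰.idx j.1) :=
    Spec.preimage (𝒰.f (𝒰.idx j.1) ≫ (X ↘ Spec (.of K)))
  refine ⟨t, inferInstance, fun j => 𝒰.X (𝒰.idx j.1), fun j => ?_, fun j => (φ j).hom.toAlgebra,
    fun j => 𝒰.f (𝒰.idx j.1), fun j => inferInstance, fun j => ?_, fun x => ?_⟩
  -- Each chart is indexed by a point that it covers, so its ring is non-trivial.
  · obtain ⟨y, -⟩ := 𝒰.covers j.1
    exact PrimeSpectrum.nonempty_iff_nontrivial.mp ⟨y⟩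
  · exact (Spec.map_preimage _).symm
  · obtain ⟨j, hj, hx⟩ := Set.mem_iUnion₂.mp (ht (Set.mem_univ x))
    exact ⟨⟨j, hj⟩, hx⟩

section Fiber

variable {I : Type*} (B : BruhatDecomposition X I) {k : ℕ}
  (Y : Fin k → (ProdAff 1 X).IdealSheafData) (w : I)

theorem mem_support_intersectionFamily (z : ProdAff k X) :
    z ∈ (intersectionFamily B Y w).support ↔
      toBase k X z ∈ (B.schubert w : Set X) ∧ ∀ i, toLine k i X z ∈ (Y i).support := by
  rw [← SetLike.mem_coe, intersectionFamily, Scheme.IdealSheafData.support_sup,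
    Scheme.IdealSheafData.support_iSup, Scheme.IdealSheafData.support_comap, Closeds.coe_inf,
    Closeds.coe_iInf, and_comm]
  simp only [Scheme.IdealSheafData.support_comap, Set.mem_inter_iff, Set.mem_iInter,
    Closeds.coe_preimage, Set.mem_preimage, BruhatDecomposition.schubertIdeal,
    Scheme.IdealSheafData.coe_support_vanishingIdeal]
  rfl

variable {A : CommRingCat.{u}} [Algebra K A] (ι : Spec A ⟶ X)

theorem mem_chartFiber_iff
    (hι : ι ≫ (X ↘ Spec (.of K)) = Spec.map (CommRingCat.ofHom (algebraMap K A)))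
    (s : ProdAff k (Spec (.of K))) (Q : PrimeSpectrum (MvPolynomial (ULift.{u} (Fin k)) A)) :
    Q ∈ chartFiber (A := A) (vanishingIdeal (R := A) (ι ⁻¹' (B.schubert w : Set X)))
        (fun i : ULift.{u} (Fin k) => lineIdeal ι (Y i.down))
        ((AffineSpace.SpecIso (ULift.{u} (Fin k)) (.of K)).hom s) ↔
      chart (ULift.{u} (Fin k)) ι Q ∈
        toAff K k X ⁻¹' {s} ∩ ((intersectionFamily B Y w).support : Set (ProdAff k X)) := by
  rw [Set.mem_inter_iff, SetLike.mem_coe, mem_support_intersectionFamily]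
  refine and_congr ?_ (and_congr ?_ ?_)
  · rw [Set.mem_preimage, Set.mem_singleton_iff, MvPolynomial.algebraMap_def]
    rw [show toAff K k X (chart (ULift.{u} (Fin k)) ι Q) = _ from chart_apply_map _ ι hι Q]
    constructor
    · intro h
      exact (congrArg (AffineSpace.SpecIso (ULift.{u} (Fin k)) (.of K)).inv h).trans (by simp)
    · rintro rfl
      simp
      rfl
  · rw [show toBase k X (chart (ULift.{u} (Fin k)) ι Q) = _ from chart_apply_over _ ι Q]
    exact vanishingIdeal_preimage_le_iff (A := A) (f := ι) ι.continuous
      (B.schubert w).isClosed (comap MvPolynomial.C Q)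
  · constructor
    · intro h i
      rw [show toLine k i X (chart (ULift.{u} (Fin k)) ι Q) = _ from chart_apply_reindex _ ι _ Q]
      exact (lineIdeal_le_iff ι (Y i) (comap _ Q)).mp (h (.up i))
    · rintro h ⟨i⟩
      have := h i
      rw [show toLine k i X (chart (ULift.{u} (Fin k)) ι Q) = _ from
        chart_apply_reindex _ ι _ Q] at this
      exact (lineIdeal_le_iff ι (Y i) (comap _ Q)).mpr this

end Fiber

theorem inGeneralPosition_of_fibreIntersection_eq_empty [IsIntegral X]
    [LocallyOfFiniteType (X ↘ Spec (.of K))] [QuasiCompact (X ↘ Spec (.of K))]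
    (hX : IsNormalScheme X) {I : Type*} (B : BruhatDecomposition X I) {r : ℕ}
    (Y : Fin r → (ProdAff 1 X).IdealSheafData) (hfam : ∀ i, IsFamilyOfCodim K (Y i) 1)
    (hempty : ∀ i, fibreIntersection (Y i) = ∅) : InGeneralPosition K B Y (fun _ => 1) := by
  intro k _ hk w
  have : CompactSpace X := QuasiCompact.compactSpace_of_compactSpace (X ↘ Spec (.of K))
  obtain ⟨J, _, A, _, _, ι, _, hι, hcov⟩ := exists_finite_affine_cover (K := K) (X := X)
  have (j : J) : Algebra.FiniteType K (A j) := finiteType_of_comp_eq (ι j) (hι j)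
  have (j : J) : IsDomain (A j) := isDomain_of_isOpenImmersion (ι j)
  set Y' : Fin k → (ProdAff 1 X).IdealSheafData := fun i => Y (Fin.castLE hk i)
  let σ := ULift.{u} (Fin k)
  let S : Set X := B.schubert w
  have hS : IsClosed S := (B.schubert w).isClosed
  have hS' : IsIrreducible S := (B.isIrreducible_cell w).closure
  let p (j : J) : Ideal (A j) := vanishingIdeal (R := A j) (ι j ⁻¹' S)
  let L (j : J) (i : σ) : Ideal (MvPolynomial (ULift.{u} (Fin 1)) (A j)) :=
    lineIdeal (ι j) (Y' i.down)
  have key (j : J) : ∃ g : MvPolynomial σ K, g ≠ 0 ∧ ∀ s : PrimeSpectrum (MvPolynomial σ K),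
      g ∉ s.asIdeal → IsEmpty (chartFiber (p j) (L j) s) ∨
        topologicalKrullDim (chartFiber (p j) (L j) s) + k = B.dim w := by
    by_cases hj : (ι j ⁻¹' S).Nonempty
    · have hp : (p j).IsPrime := by
        rw [← PrimeSpectrum.isIrreducible_iff_vanishingIdeal_isPrime]
        exact ⟨hj, hS'.isPreirreducible.preimage (ι j).isOpenEmbedding⟩
      obtain ⟨g, hg, h⟩ := exists_topologicalKrullDim_chartFiber (K := K) (σ := σ) (p j)
        (L := L j) (fun i => not_lineIdeal_le_map_C (ι j) (hempty _))
        (fun i => height_le_one_of_mem_minimalPrimes_lineIdeal ι hι hcov (hfam _) j)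
        (isIntegrallyClosed_localization hX (ι j))
      refine ⟨g, hg, fun s hs => ?_⟩
      have := h s hs
      rw [ringKrullDim_quotient_eq_topologicalKrullDim ι hι hcov hS hS' j hj] at this
      rwa [show Fintype.card σ = k by simp [σ]] at this
    -- A chart that misses `X_w` contributes only the empty set, so no condition on `s` is needed.
    · refine ⟨1, one_ne_zero, fun s _ => .inl ⟨fun Q => hj ⟨comap MvPolynomial.C Q.1, ?_⟩⟩⟩
      exact (vanishingIdeal_preimage_le_iff (A := A j) (ι j).continuous hS _).mp Q.2.2.1
  choose g hg hgs using key
  let e := AffineSpace.SpecIso σ (.of K)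
  -- Finitely many charts allow the product of the `g j`; it is non-zero, so `U` contains the
  -- generic point.
  let U : (ProdAff k (Spec (.of K))).Opens :=
    e.hom ⁻¹ᵁ (PrimeSpectrum.basicOpen (R := MvPolynomial σ K) (∏ j, g j))
  refine ⟨U, ⟨affineGenericPoint K σ, ?_⟩, fun s hs => ?_⟩
  · change e.hom (e.inv _) ∈ PrimeSpectrum.basicOpen (R := MvPolynomial σ K) (∏ j, g j)
    have h (x : Spec (.of (MvPolynomial σ K))) : e.hom (e.inv x) = x := by simp
    have h' : (⟨⊥, Ideal.isPrime_bot⟩ : PrimeSpectrum (MvPolynomial σ K)) ∈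
        PrimeSpectrum.basicOpen (∏ j, g j) :=
      fun h0 => Finset.prod_ne_zero_iff.mpr (fun j _ => hg j) h0
    exact (congrArg (fun x : PrimeSpectrum (MvPolynomial σ K) =>
      x ∈ PrimeSpectrum.basicOpen (∏ j, g j)) (h _)).mpr h'
  have hs' (j : J) : g j ∉ (show PrimeSpectrum (MvPolynomial σ K) from e.hom s).asIdeal :=
    fun h => hs (Ideal.mem_of_dvd _ (Finset.dvd_prod_of_mem g (Finset.mem_univ j)) h)
  let F := toAff K k X ⁻¹' {s} ∩ ((intersectionFamily B Y' w).support : Set (ProdAff k X))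
  let H : intersectionAt K B Y' w s ≃ₜ F :=
    fiberSubschemeHomeo (intersectionFamily B Y' w) (toAff K k X) s
  have hmem (j : J) (Q) := mem_chartFiber_iff B Y' w (ι j) (hι j) s Q
  let c (j : J) (Q : chartFiber (p j) (L j) (e.hom s)) : F :=
    ⟨chart σ (ι j) Q.1, (hmem j Q.1).mp Q.2⟩
  have hr (j : J) : Set.range (c j) = Subtype.val ⁻¹' Set.range (chart σ (ι j)) := by
    ext x
    constructor
    · rintro ⟨Q, rfl⟩
      exact ⟨Q.1, rfl⟩
    · rintro ⟨Q, hQ⟩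
      refine ⟨⟨Q, (hmem j Q).mpr ?_⟩, Subtype.ext hQ⟩
      rw [hQ]
      exact x.2
  have hop (j : J) : IsOpenEmbedding (X := PrimeSpectrum (MvPolynomial σ (A j)))
    (chart σ (ι j)) := (chart σ (ι j)).isOpenEmbedding
  -- The chart fibres form an open cover of the fibre of the intersection, and each is empty or of
  -- dimension `|w| - k`.
  have hc (j : J) : IsOpenEmbedding (c j) := by
    refine ⟨((hop j).isEmbedding.comp .subtypeVal).codRestrict F _, ?_⟩
    rw [hr]
    exact (hop j).isOpen_range.preimage continuous_subtype_val
  have hfin := isEmpty_or_topologicalKrullDim_add_eq c hc (fun x => by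
    obtain ⟨j, hj⟩ := hcov (toBase k X x.1)
    refine ⟨j, ?_⟩
    rw [hr, range_chart]
    exact hj) k (B.dim w) fun j => hgs j _ (hs' j)
  rw [← H.toEquiv.isEmpty_congr, ← IsHomeomorph.topologicalKrullDim_eq _ H.isHomeomorph] at hfin
  simpa using hfin

end SchubertInduction

theorem lemma2p4 {K : Type u} [Field K] (X : Scheme.{u}) [X.Over (Spec (.of K))]
    [IsIntegral X] [IsSeparated (X ↘ Spec (.of K))]
    [LocallyOfFiniteType (X ↘ Spec (.of K))] [QuasiCompact (X ↘ Spec (.of K))]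
    (hX : SchubertInduction.IsNormalScheme X)
    {I : Type*} (B : SchubertInduction.BruhatDecomposition X I)
    {r : ℕ} (Y : Fin r → (SchubertInduction.ProdAff 1 X).IdealSheafData)
    (hfam : ∀ i, SchubertInduction.IsFamilyOfCodim K (Y i) 1)
    (hresp : ∀ i, SchubertInduction.Respects B (Y i) 1)
    (hempty : ∀ i, SchubertInduction.fibreIntersection (Y i) = ∅) :
    SchubertInduction.InGeneralPosition K B Y (fun _ => 1) :=
  SchubertInduction.inGeneralPosition_of_fibreIntersection_eq_empty hX B Y hfam hempty
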